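/- A \emph{coloring-like problem} $P$ is given by a nonempty finite set $C$ of colors, a set $Q\subseteq C$ of special colors, a symmetric matrix $M\in\{0,1\}^{C\times C}$ and, optionally, a prime number $p$. An instance of $P$ consists of a simple graph $G=(V,E)$ on $n$ numbered vertices, a linear arrangement of $G$ (a bijection $\ell:\{1,\dots,n\}\to V$), a list $a(v)\subseteq C$ of allowed colors for every vertex $v$, numbers $N\ge 1$ and $k,W\ge 0$, and weights $\omega:V\to\{1,\dots,N\}$. The task is to compute the number of maps $c:V\to C$ such that $c(v)\in a(v)$ for every $v\in V$, $M[c(u),c(v)]=1$ for every edge $\{u,v\}\in E$, $|c^{-1}(Q)|=k$ and $\sum_{v\in c^{-1}(Q)}\omega(v)=W$; if $P$ contains a prime $p$, the task is to compute this number modulo $p$. Let $\mathrm{ctw}$ denote the cutwidth of $\ell$, i.e., the maximum over $1\le i\le n$ of the number of edges $\{\ell(j),\ell(m)\}\in E$ with $j\le i<m$ (and $0$ if $n=0$), and let $\mathrm{rank}(M)$ be the rank of $M$ over $\mathbb{F}_p$ if $P$ contains a prime $p$, and over $\mathbb{Q}$ otherwise. \textbf{Theorem.} Let $P$ be a coloring-like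 problem with $\sqrt{|C|}\le\mathrm{rank}(M)$. Then $P$ can be solved in time $\mathcal{O}^*\bigl(\mathrm{rank}(M)^{\mathrm{ctw}}\cdot N\bigr)$. That is, there are a deterministic algorithm and a polynomial $q$, both depending only on $P$, such that on every instance the algorithm outputs the required number in time at most $\mathrm{rank}(M)^{\mathrm{ctw}}\cdot N\cdot q(s)$, where $s$ is the bit length of the instance (with all numbers written in binary and the graph given by its adjacency matrix). Time is measured on a random access machine over the integers, in which a memory access is charged the bit lengths of the address and of the content, and an arithmetic operation or comparison is charged the product of the bit lengths of its operands. -/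

import Mathlib

/-! ## A random access machine with logarithmic costs

Programs are finite pieces of syntax over a memory that consists of arrays of integers. A program
names only finitely many arrays, so this is the usual integer RAM with indirect addressing, written
with structured control flow. Every operation is charged according to the bit lengths of the
integers it handles. -/

namespace RAM

/-- Number of bits needed to write down an integer, including one sign bit. -/
def bitLen (z : ℤ) : ℕ := z.natAbs.size + 1

/-- Memory contents: `σ k i` is the content of cell `i` of array `k`. -/
abbrev Memory : Type := ℕ → ℤ → ℤ

/-- Binary operations on integers; the comparisons return `1` (true) or `0` (false). -/
inductive Op : Type
  | add | sub | mul | div | mod | lt | eq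

/-- The value of a binary operation. -/
def Op.eval : Op → ℤ → ℤ → ℤ
  | .add, x, y => x + y
  | .sub, x, y => x - y
  | .mul, x, y => x * y
  | .div, x, y => x / y
  | .mod, x, y => x % y
  | .lt, x, y => if x < y then 1 else 0
  | .eq, x, y => if x = y then 1 else 0

/-- Expressions: integer constants, reading a cell of an array, and binary operations. -/
inductive Term : Type
  | const (z : ℤ)
  | load (k : ℕ) (idx : Term)
  | app (o : Op) (x y : Term)

/-- The value of an expression. -/
def Term.eval (σ : Memory) : Term → ℤ
  | .const z => z
  | .load k idx => σ k (idx.eval σ)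
  | .app o x y => o.eval (x.eval σ) (y.eval σ)

/-- The time to evaluate an expression: constants cost their bit length, a memory access costs the
bit lengths of the address and of the content, and a binary operation costs the product of the bit
lengths of its two arguments (the cost of schoolbook arithmetic). -/
def Term.cost (σ : Memory) : Term → ℕ
  | .const z => bitLen z
  | .load k idx => idx.cost σ + bitLen (idx.eval σ) + bitLen (σ k (idx.eval σ))
  | .app _ x y => x.cost σ + y.cost σ + bitLen (x.eval σ) * bitLen (y.eval σ)

/-- Programs. Tests succeed when the value of the tested expression is nonzero. -/
inductive Prog : Type
  | nop
  | store (k : ℕ) (idx val : Term)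
  | seq (c d : Prog)
  | cond (b : Term) (c d : Prog)
  | loop (b : Term) (c : Prog)

/-- Writing the value `z` into cell `i` of array `k`. -/
def Memory.write (σ : Memory) (k : ℕ) (i z : ℤ) : Memory :=
  Function.update σ k (Function.update (σ k) i z)

/-- `Exec c σ τ t`: started in memory `σ`, the program `c` halts in memory `τ` after running for
time exactly `t`. -/
inductive Exec : Prog → Memory → Memory → ℕ → Prop
  | nop (σ : Memory) : Exec .nop σ σ 1
  | store (σ : Memory) (k : ℕ) (idx val : Term) :
      Exec (.store k idx val) σ (σ.write k (idx.eval σ) (val.eval σ))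
        (idx.cost σ + val.cost σ + bitLen (idx.eval σ) + bitLen (val.eval σ))
  | seq {c d : Prog} {σ τ υ : Memory} {s t : ℕ} :
      Exec c σ τ s → Exec d τ υ t → Exec (.seq c d) σ υ (s + t)
  | cond_true {b : Term} {c d : Prog} {σ τ : Memory} {t : ℕ} :
      b.eval σ ≠ 0 → Exec c σ τ t → Exec (.cond b c d) σ τ (b.cost σ + 1 + t)
  | cond_false {b : Term} {c d : Prog} {σ τ : Memory} {t : ℕ} :
      b.eval σ = 0 → Exec d σ τ t → Exec (.cond b c d) σ τ (b.cost σ + 1 + t)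
  | loop_true {b : Term} {c : Prog} {σ τ υ : Memory} {s t : ℕ} :
      b.eval σ ≠ 0 → Exec c σ τ s → Exec (.loop b c) τ υ t →
        Exec (.loop b c) σ υ (b.cost σ + 1 + s + t)
  | loop_false {b : Term} {c : Prog} {σ : Memory} :
      b.eval σ = 0 → Exec (.loop b c) σ σ (b.cost σ + 1)

/-- The initial memory for an input that is a list of arrays: the arrays are loaded into arrays
`0, 1, …` (each starting at cell `0`), and all remaining cells contain `0`. -/
def initialMemory (input : List (List ℤ)) : Memory := fun k i =>
  if 0 ≤ i then (input.getD k []).getD i.toNat 0 else 0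

/-- The bit size of an input: the total number of bits of all its integers. -/
def inputSize (input : List (List ℤ)) : ℕ := (input.flatten.map bitLen).sum

end RAM

/-! ## Linear arrangements and cutwidth -/

section Cutwidth

variable {n : ℕ}

open Classical in
/-- The `i`th cut of the linear arrangement `ℓ` of `G`: the edges `{ℓ j, ℓ k}` with
`j ≤ i < k`. -/
noncomputable def arrangementCut (G : SimpleGraph (Fin n)) (ℓ : Fin n ≃ Fin n) (i : Fin n) :
    Finset (Sym2 (Fin n)) :=
  G.edgeFinset.filter (fun e => ∃ j k : Fin n, j ≤ i ∧ i < k ∧ e = s(ℓ j, ℓ k))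

/-- The cutwidth of a linear arrangement: the largest size of a cut. -/
noncomputable def arrangementCutwidth (G : SimpleGraph (Fin n)) (ℓ : Fin n ≃ Fin n) : ℕ :=
  Finset.univ.sup (fun i => (arrangementCut G ℓ i).card)

end Cutwidth

/-! ## Coloring-like problems -/

/-- A coloring-like problem: a nonempty finite set of colors (here `Fin numColors`), a set of
special colors, a symmetric 0/1 consistency matrix and, optionally, a prime number. -/
structure ColoringLikeProblem where
  numColors : ℕ
  numColors_pos : 0 < numColors
  special : Finset (Fin numColors)
  M : Matrix (Fin numColors) (Fin numColors) ℕ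
  M_zero_one : ∀ c d, M c d = 0 ∨ M c d = 1
  M_symm : M.IsSymm
  prime : Option ℕ
  prime_isPrime : ∀ p ∈ prime, p.Prime

namespace ColoringLikeProblem

/-- The rank of the consistency matrix: over `𝔽_p` if the problem contains a prime `p`, and over
`ℚ` otherwise. -/
noncomputable def rank (P : ColoringLikeProblem) : ℕ :=
  match P.prime with
  | none => (P.M.map (fun x : ℕ => (x : ℚ))).rank
  | some p => (P.M.map (fun x : ℕ => (x : ZMod p))).rank

/-- An instance of a coloring-like problem. The vertices of the graph are numbered; the linear
arrangement `ℓ` maps positions to vertices and is independent of that numbering. -/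
structure Instance (P : ColoringLikeProblem) where
  n : ℕ
  G : SimpleGraph (Fin n)
  ℓ : Fin n ≃ Fin n
  lists : Fin n → Finset (Fin P.numColors)
  N : ℕ
  N_pos : 0 < N
  order : ℕ
  weight : ℕ
  ω : Fin n → ℕ
  ω_mem : ∀ v, ω v ∈ Finset.Icc 1 N

variable {P : ColoringLikeProblem}

/-- The cutwidth of the linear arrangement that is part of the instance. -/
noncomputable def Instance.ctw (I : P.Instance) : ℕ := arrangementCutwidth I.G I.ℓ

/-- The colorings to be counted. -/
def Instance.IsSolution (I : P.Instance) (c : Fin I.n → Fin P.numColors) : Prop :=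
  (Finset.univ.filter (fun v => c v ∈ P.special)).card = I.order ∧
  ∑ v ∈ Finset.univ.filter (fun v => c v ∈ P.special), I.ω v = I.weight ∧
  (∀ v, c v ∈ I.lists v) ∧
  ∀ u v, I.G.Adj u v → P.M (c u) (c v) = 1

/-- The number of colorings that are asked for. -/
noncomputable def Instance.count (I : P.Instance) : ℕ :=
  Nat.card {c : Fin I.n → Fin P.numColors // I.IsSolution c}

/-- The value to be computed: the number of colorings, reduced modulo `p` if the problem contains a
prime `p`. -/
noncomputable def Instance.answer (I : P.Instance) : ℕ :=
  match P.prime with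
  | none => I.count
  | some p => I.count % p

open Classical in
/-- The input by which an instance is presented to a machine: the four numbers of the instance, the
linear arrangement, the weights, the adjacency matrix (row by row), and the lists of allowed colors
(one row of 0/1 entries per vertex). -/
noncomputable def Instance.encode (I : P.Instance) : List (List ℤ) :=
  [[(I.n : ℤ), (I.N : ℤ), (I.order : ℤ), (I.weight : ℤ)],
    List.ofFn (fun i : Fin I.n => ((I.ℓ i : ℕ) : ℤ)),
    List.ofFn (fun v : Fin I.n => (I.ω v : ℤ)),
    List.ofFn (fun e : Fin (I.n * I.n) => if I.G.Adj e.divNat e.modNat then 1 else 0),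
    List.ofFn (fun e : Fin (I.n * P.numColors) => if e.modNat ∈ I.lists e.divNat then 1 else 0)]

/-- The size of an instance: the number of bits of its encoding. -/
noncomputable def Instance.size (I : P.Instance) : ℕ := RAM.inputSize I.encode

/-- `P` can be solved in time `O*(f)`: there is one program that on every instance `I` halts with
the requested value in cell `0` of array `0`, after time at most `f I` times a fixed polynomial in
the size of `I`. -/
def SolvableInTimeOStar (P : ColoringLikeProblem) (f : P.Instance → ℕ) : Prop :=
  ∃ (prog : RAM.Prog) (q : Polynomial ℕ), ∀ I : P.Instance,
    ∃ (τ : RAM.Memory) (t : ℕ),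
      RAM.Exec prog (RAM.initialMemory I.encode) τ t ∧
      τ 0 0 = (I.answer : ℤ) ∧
      t ≤ f I * q.eval I.size

end ColoringLikeProblem

/-!
A factorization `M = L * R` of the consistency matrix through a space of dimension `r = rank M`
turns every edge `{u, v}` of the graph into a sum over `r` indices `d`, the edge being split into a
factor `L (c u) d` at its left end and a factor `R d (c v)` at its right end. Hence, after the
vertices in the first `i` positions have been treated, all that has to be remembered about their
colorings is a table indexed by one number below `r` for each edge of the `i`th cut, together with
the weight. The table has at most `r ^ ctw` entries for each weight, whatever the number of colors.

The next vertex is processed separately for each of its colors: every edge to an earlier vertex is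
contracted (`Network.colorTable_succ_right`, one index is summed out), after that every edge to a
later vertex gets a new index (`Network.colorTable_succ_left`), and finally the tables of the colors
are added (`Network.table_succ`). Because the contractions come first, no table needs more indices
than the larger of two cuts (`Network.digits_le`). A table is stored as an array whose addresses
have the indices as lowest base `r` digits (`tval`). The top part of the address is
`order * (n * N + 1) + weight`, so that a special vertex amounts to a shift of the array
(`tval_add`), and reading below address `0` yields the value `0` that is needed there.

All calculations are carried out modulo a number `m`, which keeps the integers short. If the problem
contains a prime, it is taken as `m`. Otherwise `D • M = L * R` with integer matrices `L`, `R` and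
some `D > 0`, and `m = D * C ^ n + 1` is larger than the number of colorings, while `D` has the
inverse `-C ^ n` modulo `m` (`ColoringLikeProblem.exists_params`).

The program is verified in a small program logic: `RAM.Does X σ c Q` bounds the running time of `c`
by a constant that depends on the text of `c` only, times `X`. For a memory with entries of at most
`V` in absolute value, a straight-line program has `X = (width V) ^ 2`, and each enclosing loop
contributes a factor (`RAM.Does.loop`). The hypothesis on the rank makes `r` positive; for rank
`0` the claimed time bound would vanish as soon as the graph has an edge.
-/

/-! ### Expressions: notation, evaluation and cost -/

namespace RAM

instance : Add Term := ⟨.app .add⟩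
instance : Sub Term := ⟨.app .sub⟩
instance : Mul Term := ⟨.app .mul⟩
instance : Div Term := ⟨.app .div⟩
instance : Mod Term := ⟨.app .mod⟩

/-- The expression comparing two values with `<`. -/
def Term.lt (x y : Term) : Term := .app .lt x y

/-- The expression comparing two values for equality. -/
def Term.eq (x y : Term) : Term := .app .eq x y

/-- The scalar variable kept in cell `0` of array `k`. -/
def var (k : ℕ) : Term := .load k (.const 0)

/-- The sum of finitely many expressions. -/
def Term.sum (l : List Term) : Term := l.foldr (· + ·) (.const 0)

/-- Selection from a finite constant table: `f x` if `x < k`, and `0` otherwise. -/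
def Term.table (k : ℕ) (f : ℕ → ℤ) (x : Term) : Term :=
  .sum ((List.range k).map fun d : ℕ => .const (f d) * Term.eq x (.const d))

/-- Selection from a finite constant matrix. -/
def Term.matrix (k l : ℕ) (f : ℕ → ℕ → ℤ) (x y : Term) : Term :=
  .sum ((List.range k).map fun c : ℕ => Term.table l (f c) y * Term.eq x (.const c))

section eval

variable (σ : Memory) (x y : Term)

@[simp] theorem Term.eval_const (z : ℤ) : (Term.const z).eval σ = z := rfl
@[simp] theorem Term.eval_load (k : ℕ) : (Term.load k x).eval σ = σ k (x.eval σ) := rfl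
@[simp] theorem eval_var (k : ℕ) : (var k).eval σ = σ k 0 := rfl
@[simp] theorem Term.eval_add : (x + y).eval σ = x.eval σ + y.eval σ := rfl
@[simp] theorem Term.eval_sub : (x - y).eval σ = x.eval σ - y.eval σ := rfl
@[simp] theorem Term.eval_mul : (x * y).eval σ = x.eval σ * y.eval σ := rfl
@[simp] theorem Term.eval_div : (x / y).eval σ = x.eval σ / y.eval σ := rfl
@[simp] theorem Term.eval_mod : (x % y).eval σ = x.eval σ % y.eval σ := rfl
@[simp] theorem Term.eval_lt :
    (Term.lt x y).eval σ = if x.eval σ < y.eval σ then 1 else 0 := rfl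
@[simp] theorem Term.eval_eq :
    (Term.eq x y).eval σ = if x.eval σ = y.eval σ then 1 else 0 := rfl

@[simp] theorem Term.eval_sum (l : List Term) :
    (Term.sum l).eval σ = (l.map fun t => t.eval σ).sum := by
  induction l with
  | nil => rfl
  | cons a l ih => simpa [Term.sum] using ih

theorem sum_map_range {R : Type*} [AddCommMonoid R] (k : ℕ) (f : ℕ → R) :
    ((List.range k).map f).sum = ∑ d ∈ Finset.range k, f d := by
  induction k with
  | zero => simp
  | succ k ih => simp [List.range_succ, Finset.sum_range_succ, ih]

theorem Term.eval_sum_range (k : ℕ) (f : ℕ → Term) :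
    (Term.sum ((List.range k).map f)).eval σ = ∑ d ∈ Finset.range k, (f d).eval σ := by
  rw [Term.eval_sum, List.map_map, sum_map_range]
  rfl

theorem Term.eval_table {σ : Memory} {x : Term} {k d : ℕ} (f : ℕ → ℤ) (hx : x.eval σ = d)
    (hd : d < k) : (Term.table k f x).eval σ = f d := by
  rw [Term.table, Term.eval_sum_range, Finset.sum_eq_single d] <;> simp_all
  omega

theorem Term.eval_matrix {σ : Memory} {x y : Term} {k l c d : ℕ} (f : ℕ → ℕ → ℤ)
    (hx : x.eval σ = c) (hy : y.eval σ = d) (hc : c < k) (hd : d < l) :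
    (Term.matrix k l f x y).eval σ = f c d := by
  rw [Term.matrix, Term.eval_sum_range, Finset.sum_eq_single c]
  · simp [Term.eval_table (f c) hy hd, hx]
  · intro b _ hb
    simp [hx]
    omega
  · simp [hc]

end eval

/-- All cells of the memory hold integers of absolute value at most `V`. -/
def Bounded (V : ℕ) (σ : Memory) : Prop := ∀ k i, (σ k i).natAbs ≤ V

/-- A bound for the bit length of integers of absolute value at most `V`. -/
def width (V : ℕ) : ℕ := V.size + 1

theorem one_le_width (V : ℕ) : 1 ≤ width V := Nat.le_add_left ..

theorem bitLen_le_width {V : ℕ} {z : ℤ} (h : z.natAbs ≤ V) : bitLen z ≤ width V :=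
  Nat.add_le_add_right (Nat.size_le_size h) 1

theorem one_le_bitLen (z : ℤ) : 1 ≤ bitLen z := Nat.le_add_left ..

/-- The sign bits make up for the carry of an addition and for the results of comparisons. -/
theorem bitLen_eval_le (o : Op) (x y : ℤ) : bitLen (o.eval x y) ≤ bitLen x + bitLen y := by
  have size_le {a b : ℤ} {k : ℕ} (h : a.natAbs < 2 ^ k) : a.natAbs.size ≤ k := Nat.size_le.2 h
  have hx := Nat.lt_size_self x.natAbs
  have hy := Nat.lt_size_self y.natAbs
  have hx1 : 2 ^ x.natAbs.size ≤ 2 ^ (x.natAbs.size + y.natAbs.size) :=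
    Nat.pow_le_pow_right (by norm_num) (Nat.le_add_right ..)
  have hy1 : 2 ^ y.natAbs.size ≤ 2 ^ (x.natAbs.size + y.natAbs.size) :=
    Nat.pow_le_pow_right (by norm_num) (Nat.le_add_left ..)
  have key : (o.eval x y).natAbs < 2 ^ (x.natAbs.size + y.natAbs.size + 1) := by
    rw [pow_succ]
    cases o with
    | add => simp only [Op.eval]; omega
    | sub => simp only [Op.eval]; omega
    | mul =>
      simp only [Op.eval, Int.natAbs_mul]
      have := Nat.mul_lt_mul'' hx hy
      rw [← pow_add] at this
      omega
    | div =>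
      simp only [Op.eval]
      have := Int.natAbs_ediv_le_natAbs x y
      omega
    | mod =>
      simp only [Op.eval]
      by_cases h : y = 0
      · subst h; simp only [Int.emod_zero]; omega
      · have h1 := Int.emod_nonneg x h
        have h2 := Int.emod_lt x h
        omega
    | lt =>
      simp only [Op.eval]
      split_ifs
      · have := Nat.one_le_two_pow (n := x.natAbs.size + y.natAbs.size); simp; omega
      · have := Nat.one_le_two_pow (n := x.natAbs.size + y.natAbs.size); simp
    | eq =>
      simp only [Op.eval]
      split_ifs
      · have := Nat.one_le_two_pow (n := x.natAbs.size + y.natAbs.size); simp; omega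
      · have := Nat.one_le_two_pow (n := x.natAbs.size + y.natAbs.size); simp
  have := Nat.size_le.2 key
  simp only [bitLen]
  omega

/-- A bound for the bit length of the value in a bounded memory, in multiples of the width. -/
def Term.bits : Term → ℕ
  | .const z => bitLen z
  | .load _ _ => 1
  | .app _ x y => x.bits + y.bits

/-- The cost of an expression in a bounded memory, in multiples of the squared width. -/
def Term.factor : Term → ℕ
  | .const z => bitLen z
  | .load _ idx => idx.factor + idx.bits + 1
  | .app _ x y => x.factor + y.factor + x.bits * y.bits

theorem Term.bitLen_eval_le {V : ℕ} {σ : Memory} (h : Bounded V σ) (t : Term) :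
    bitLen (t.eval σ) ≤ t.bits * width V := by
  induction t with
  | const z => exact Nat.le_mul_of_pos_right _ (one_le_width V)
  | load k idx _ => simpa [Term.bits] using bitLen_le_width (h _ _)
  | app o x y hx hy =>
    refine (RAM.bitLen_eval_le o _ _).trans ?_
    rw [Term.bits, add_mul]
    exact add_le_add hx hy

theorem Term.cost_le {V : ℕ} {σ : Memory} (h : Bounded V σ) (t : Term) :
    t.cost σ ≤ t.factor * width V ^ 2 := by
  have h1 := one_le_width V
  have h2 : width V ≤ width V ^ 2 := Nat.le_self_pow (by norm_num) _
  induction t with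
  | const z => exact Nat.le_mul_of_pos_right _ (by positivity)
  | load k idx ih =>
    have hi := Term.bitLen_eval_le h idx
    have hv := bitLen_le_width (h k (idx.eval σ))
    simp only [Term.cost, Term.factor]
    nlinarith [Nat.mul_le_mul_left idx.bits h2]
  | app o x y hx hy =>
    have := Nat.mul_le_mul (Term.bitLen_eval_le h x) (Term.bitLen_eval_le h y)
    simp only [Term.cost, Term.factor]
    nlinarith

/-! ### Programs: a logic for correctness and running time -/

/-- The time of a program apart from repetitions of loops, in multiples of the squared width. -/
def Prog.factor : Prog → ℕ
  | .nop => 1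
  | .store _ idx val => idx.factor + val.factor + idx.bits + val.bits
  | .seq c d => c.factor + d.factor
  | .cond b c d => b.factor + 1 + c.factor + d.factor
  | .loop b c => b.factor + 1 + c.factor

/-- Started in `σ`, the program `c` halts after time at most `c.factor * X` in a memory with
property `Q`. The time unit `X` covers the width of the memory and the repetitions of loops. -/
def Does (X : ℕ) (σ : Memory) (c : Prog) (Q : Memory → Prop) : Prop :=
  ∃ τ t, Exec c σ τ t ∧ t ≤ c.factor * X ∧ Q τ

variable {V X Y : ℕ} {σ : Memory} {Q Q' : Memory → Prop} {b : Term} {c d : Prog}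

theorem Does.mono (h : Does X σ c Q) (hX : X ≤ Y) (hQ : ∀ τ, Q τ → Q' τ) : Does Y σ c Q' := by
  obtain ⟨τ, t, h1, h2, h3⟩ := h
  exact ⟨τ, t, h1, h2.trans (Nat.mul_le_mul_left _ hX), hQ _ h3⟩

theorem Does.nop (hX : width V ^ 2 ≤ X) (h : Q σ) : Does X σ .nop Q := by
  have : 0 < width V ^ 2 := pow_pos (one_le_width V) 2
  exact ⟨σ, 1, .nop σ, by simp [Prog.factor]; omega, h⟩

theorem Does.store (hσ : Bounded V σ) (hX : width V ^ 2 ≤ X) {k : ℕ} {idx val : Term}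
    (h : Q (σ.write k (idx.eval σ) (val.eval σ))) : Does X σ (.store k idx val) Q := by
  have h2 : width V ≤ width V ^ 2 := Nat.le_self_pow (by norm_num) _
  refine ⟨_, _, .store σ k idx val, ?_, h⟩
  refine le_trans ?_ (Nat.mul_le_mul_left _ hX)
  have := Term.cost_le hσ idx
  have := Term.cost_le hσ val
  have := (Term.bitLen_eval_le hσ idx).trans (Nat.mul_le_mul_left _ h2)
  have := (Term.bitLen_eval_le hσ val).trans (Nat.mul_le_mul_left _ h2)
  simp only [Prog.factor, add_mul]
  omega

theorem Does.seq (h : Does X σ c fun τ => Does X τ d Q) : Does X σ (.seq c d) Q := by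
  obtain ⟨τ, t, h1, h2, υ, s, h3, h4, h5⟩ := h
  exact ⟨υ, t + s, .seq h1 h3, by simp only [Prog.factor, add_mul]; omega, h5⟩

theorem Does.cond (hσ : Bounded V σ) (hX : width V ^ 2 ≤ X)
    (h1 : b.eval σ ≠ 0 → Does X σ c Q) (h0 : b.eval σ = 0 → Does X σ d Q) :
    Does X σ (.cond b c d) Q := by
  have hb := (Term.cost_le hσ b).trans (Nat.mul_le_mul_left _ hX)
  have h3 : 1 ≤ X := le_trans (Nat.one_le_pow 2 _ (one_le_width V)) hX
  by_cases h : b.eval σ = 0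
  · obtain ⟨τ, t, h4, h5, h6⟩ := h0 h
    refine ⟨τ, _, .cond_false h h4, ?_, h6⟩
    simp only [Prog.factor, add_mul]
    omega
  · obtain ⟨τ, t, h4, h5, h6⟩ := h1 h
    refine ⟨τ, _, .cond_true h h4, ?_, h6⟩
    simp only [Prog.factor, add_mul]
    omega

/-- A loop with an invariant indexed by the number of completed rounds. -/
theorem Does.loop (Inv : ℕ → Memory → Prop) (N : ℕ) (hX : width V ^ 2 ≤ X)
    (hV : ∀ i σ, Inv i σ → Bounded V σ)
    (step : ∀ i < N, ∀ σ, Inv i σ → b.eval σ ≠ 0 ∧ Does X σ c (Inv (i + 1)))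
    (halt : ∀ σ, Inv N σ → b.eval σ = 0) (h0 : Inv 0 σ) :
    Does (X * (N + 1)) σ (.loop b c) (Inv N) := by
  have h3 : 1 ≤ X := le_trans (Nat.one_le_pow 2 _ (one_le_width V)) hX
  suffices h : ∀ k ≤ N, ∀ σ, Inv (N - k) σ →
      ∃ τ t, Exec (.loop b c) σ τ t ∧ t ≤ (b.factor + 1 + c.factor) * (X * (k + 1)) ∧ Inv N τ by
    exact h N le_rfl σ (by simpa using h0)
  intro k
  induction k with
  | zero =>
    intro _ σ hσ
    have hb := (Term.cost_le (hV _ _ hσ) b).trans (Nat.mul_le_mul_left _ hX)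
    refine ⟨σ, _, .loop_false (halt σ hσ), ?_, hσ⟩
    nlinarith
  | succ k ih =>
    intro hk σ hσ
    have hb := (Term.cost_le (hV _ _ hσ) b).trans (Nat.mul_le_mul_left _ hX)
    obtain ⟨h1, τ, t, h4, h5, h6⟩ := step _ (by omega) σ hσ
    rw [show N - (k + 1) + 1 = N - k by omega] at h6
    obtain ⟨υ, s, h7, h8, h9⟩ := ih (by omega) τ h6
    refine ⟨υ, _, .loop_true h1 h4 h7, ?_, h9⟩
    nlinarith

/-- The program contains an assignment to array `k`. -/
def Prog.Writes (k : ℕ) : Prog → Prop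
  | .nop => False
  | .store k' _ _ => k' = k
  | .seq c d => c.Writes k ∨ d.Writes k
  | .cond _ c d => c.Writes k ∨ d.Writes k
  | .loop _ c => c.Writes k

theorem Exec.apply_eq_of_not_writes {τ : Memory} {t k : ℕ} (h : Exec c σ τ t)
    (hk : ¬ c.Writes k) : τ k = σ k := by
  induction h with
  | nop => rfl
  | store σ k' idx val => exact Function.update_of_ne (Ne.symm hk) _ _
  | seq _ _ ih1 ih2 => exact (ih2 fun h => hk (Or.inr h)).trans (ih1 fun h => hk (Or.inl h))
  | cond_true _ _ ih => exact ih fun h => hk (Or.inl h)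
  | cond_false _ _ ih => exact ih fun h => hk (Or.inr h)
  | loop_true _ _ _ ih1 ih2 => exact (ih2 hk).trans (ih1 hk)
  | loop_false _ => rfl

theorem Does.and_apply_eq (h : Does X σ c Q) {k : ℕ} (hk : ¬ c.Writes k) :
    Does X σ c fun τ => Q τ ∧ τ k = σ k := by
  obtain ⟨τ, t, h1, h2, h3⟩ := h
  exact ⟨τ, t, h1, h2, h3, h1.apply_eq_of_not_writes hk⟩

theorem write_apply (σ : Memory) (k k' : ℕ) (i i' z : ℤ) :
    σ.write k i z k' i' = if k' = k ∧ i' = i then z else σ k' i' := by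
  unfold Memory.write
  by_cases h : k' = k
  · subst h
    by_cases h' : i' = i <;> simp [h']
  · simp [h]

theorem Bounded.write (h : Bounded V σ) (k : ℕ) (i : ℤ) {z : ℤ} (hz : z.natAbs ≤ V) :
    Bounded V (σ.write k i z) := by
  intro k' i'
  rw [write_apply]
  split_ifs
  exacts [hz, h _ _]

/-- Fill the cells `0, 1, …, bnd - 1` of array `D` in this order with the values of `val`, where
the current cell number is in variable `x`. -/
def sweepUp (x D : ℕ) (bnd val : Term) : Prog :=
  .seq (.store x (.const 0) (.const 0))
    (.loop ((var x).lt bnd)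
      (.seq (.store D (var x) val) (.store x (.const 0) (var x + .const 1))))

/-- Fill the cells `bnd - 1, …, 1, 0` of array `D` in this order with the values of `val`, where
the current cell number is in variable `x`. -/
def sweepDown (x D : ℕ) (bnd val : Term) : Prog :=
  .seq (.store x (.const 0) bnd)
    (.loop ((Term.const 0).lt (var x))
      (.seq (.store x (.const 0) (var x - .const 1)) (.store D (var x) val)))

/-- `τ` arises from `σ` by changing arrays `x` and `D` only, in the latter only cells in `S`. -/
def Changes (x D : ℕ) (S : ℤ → Prop) (σ τ : Memory) : Prop :=
  (∀ k, k ≠ x → k ≠ D → τ k = σ k) ∧ ∀ z, ¬ S z → τ D z = σ D z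

/-- An ascending sweep. The value for cell `a` is computed while the cells from `a` on still have
their old contents, so it may depend on these. -/
theorem does_sweepUp {m : ℕ} (F : ℕ → ZMod m) {x D cnt W : ℕ} {bnd val : Term}
    (hσ : Bounded V σ) (hX : width V ^ 2 ≤ X) (hxD : x ≠ D) (hcV : cnt ≤ V) (hcW : cnt ≤ W)
    (hbnd : ∀ τ, (∀ k, k ≠ x → k ≠ D → τ k = σ k) → bnd.eval τ = cnt)
    (hval : ∀ a < cnt, ∀ τ, Bounded V τ → Changes x D (fun z => 0 ≤ z ∧ z < a) σ τ → τ x 0 = a →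
      (val.eval τ).natAbs ≤ V ∧ (val.eval τ : ZMod m) = F a)
    (hQ : ∀ τ, Bounded V τ → Changes x D (fun z => 0 ≤ z ∧ z < cnt) σ τ →
      (∀ a < cnt, (τ D a : ZMod m) = F a) → Q τ) :
    Does (X * (W + 1)) σ (sweepUp x D bnd val) Q := by
  have hXW : X * (cnt + 1) ≤ X * (W + 1) := Nat.mul_le_mul_left _ (by omega)
  have hX' : width V ^ 2 ≤ X * (W + 1) := hX.trans (Nat.le_mul_of_pos_right _ (by omega))
  refine Does.seq (Does.store hσ hX' ?_)
  let Inv : ℕ → Memory → Prop := fun i τ => Bounded V τ ∧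
    Changes x D (fun z => 0 ≤ z ∧ z < i) σ τ ∧ τ x 0 = i ∧ ∀ a < i, (τ D a : ZMod m) = F a
  refine (Does.loop Inv cnt hX (fun i τ h => h.1) ?_ ?_ ?_).mono hXW ?_
  · rintro i hi τ ⟨h1, h2, h3, h4⟩
    refine ⟨by simp [hbnd τ h2.1, h3, hi], Does.seq (Does.store h1 hX ?_)⟩
    obtain ⟨h5, h6⟩ := hval i hi τ h1 h2 h3
    have h7 := h1.write D ((var x).eval τ) h5
    refine Does.store h7 hX ⟨h7.write _ _ ?_, ⟨?_, ?_⟩, ?_, ?_⟩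
    · simp [write_apply, hxD, h3]
      omega
    · intro k hk hk'
      funext z
      simp [write_apply, hk, hk', h2.1 k hk hk']
    · intro z hz
      have hz' : z ≠ i := by push_cast at hz; omega
      simp [write_apply, hxD.symm, h3, hz']
      exact h2.2 z (by push_cast at hz; omega)
    · simp [write_apply, hxD, h3]
    · intro a ha
      by_cases hai : a = i
      · subst hai
        simp [write_apply, hxD.symm, h3, h6]
      · simp [write_apply, hxD.symm, h3, hai, h4 a (by omega)]
  · rintro τ ⟨h1, h2, h3, h4⟩
    simp [hbnd τ h2.1, h3]
  · refine ⟨hσ.write _ _ (by simp), ⟨?_, ?_⟩, by simp [write_apply], by simp⟩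
    · intro k hk hk'
      funext z
      simp [write_apply, hk]
    · intro z _
      simp [write_apply, hxD.symm]
  · rintro τ ⟨h1, h2, h3, h4⟩
    exact hQ τ h1 h2 h4

/-- A descending sweep. The value for cell `a` may depend on the old contents of the cells up to
`a`. -/
theorem does_sweepDown {m : ℕ} (F : ℕ → ZMod m) {x D cnt W : ℕ} {bnd val : Term}
    (hσ : Bounded V σ) (hX : width V ^ 2 ≤ X) (hxD : x ≠ D) (hcV : cnt ≤ V) (hcW : cnt ≤ W)
    (hbnd : bnd.eval σ = cnt)
    (hval : ∀ a < cnt, ∀ τ, Bounded V τ → Changes x D (fun z => a < z) σ τ → τ x 0 = a →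
      (val.eval τ).natAbs ≤ V ∧ (val.eval τ : ZMod m) = F a)
    (hQ : ∀ τ, Bounded V τ → Changes x D (fun z => 0 ≤ z) σ τ →
      (∀ a < cnt, (τ D a : ZMod m) = F a) → Q τ) :
    Does (X * (W + 1)) σ (sweepDown x D bnd val) Q := by
  have hXW : X * (cnt + 1) ≤ X * (W + 1) := Nat.mul_le_mul_left _ (by omega)
  have hX' : width V ^ 2 ≤ X * (W + 1) := hX.trans (Nat.le_mul_of_pos_right _ (by omega))
  refine Does.seq (Does.store hσ hX' ?_)
  let Inv : ℕ → Memory → Prop := fun i τ => Bounded V τ ∧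
    Changes x D (fun z => ((cnt - i : ℕ) : ℤ) ≤ z) σ τ ∧ τ x 0 = ((cnt - i : ℕ) : ℤ) ∧
    ∀ a < cnt, cnt - i ≤ a → (τ D a : ZMod m) = F a
  refine (Does.loop Inv cnt hX (fun i τ h => h.1) ?_ ?_ ?_).mono hXW ?_
  · rintro i hi τ ⟨h1, h2, h3, h4⟩
    obtain ⟨a, rfl⟩ : ∃ a, cnt = a + i + 1 := ⟨cnt - i - 1, by omega⟩
    rw [show a + i + 1 - i = a + 1 by omega] at h2 h3 h4
    have e1 : a + i + 1 - (i + 1) = a := by omega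
    refine ⟨by simp [h3], Does.seq (Does.store h1 hX ?_)⟩
    have h5 : Bounded V (τ.write x ((Term.const 0).eval τ) ((var x - .const 1).eval τ)) :=
      h1.write _ _ (by simp [h3]; omega)
    have h6 : Changes x D (fun z => (a : ℤ) < z) σ
        (τ.write x ((Term.const 0).eval τ) ((var x - .const 1).eval τ)) := by
      refine ⟨?_, ?_⟩
      · intro k hk hk'
        funext z
        simp [write_apply, hk, h2.1 k hk hk']
      · intro z hz
        simp [write_apply, hxD.symm]
        exact h2.2 z (by push_cast; omega)
    have h7 : τ.write x ((Term.const 0).eval τ) ((var x - .const 1).eval τ) x 0 = a := by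
      simp [write_apply, h3]
    have h10 : ∀ z, τ.write x ((Term.const 0).eval τ) ((var x - .const 1).eval τ) D z = τ D z := by
      intro z
      simp [write_apply, hxD.symm]
    generalize τ.write x ((Term.const 0).eval τ) ((var x - .const 1).eval τ) = υ
      at h5 h6 h7 h10 ⊢
    obtain ⟨h8, h9⟩ := hval a (by omega) υ h5 h6 h7
    refine Does.store h5 hX ⟨h5.write _ _ h8, ⟨?_, ?_⟩, ?_, ?_⟩
    · intro k hk hk'
      funext z
      simp [write_apply, hk', h6.1 k hk hk']
    · intro z hz
      have hz' : z ≠ a := by rw [e1] at hz; omega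
      simp [write_apply, h7, hz']
      exact h6.2 z (by rw [e1] at hz; omega)
    · simp [write_apply, hxD, h7, e1]
    · intro a' ha ha'
      by_cases haa : a' = a
      · subst haa
        simp [write_apply, h7, h9]
      · rw [← h4 a' ha (by omega)]
        simp [write_apply, h7, haa, h10]
  · rintro τ ⟨h1, h2, h3, h4⟩
    simp [h3]
  · refine ⟨hσ.write _ _ (by simp [hbnd, hcV]), ⟨?_, ?_⟩, by simp [write_apply, hbnd], ?_⟩
    · intro k hk hk'
      funext z
      simp [write_apply, hk]
    · intro z _
      simp [write_apply, hxD.symm]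
    · intro a ha ha'
      omega
  · rintro τ ⟨h1, h2, h3, h4⟩
    exact hQ τ h1 (by simpa using h2) (fun a ha => h4 a ha (by omega))

end RAM

/-! ### Codes of table entries -/

section Tval

variable {𝕜 : Type*}

/-- The number of digits used by a list of pairs. -/
def slots (l : List (𝕜 ⊕ ℕ)) : ℕ := l.countP Sum.isRight

@[simp] theorem slots_nil : slots ([] : List (𝕜 ⊕ ℕ)) = 0 := rfl
@[simp] theorem slots_inl (x : 𝕜) (l : List (𝕜 ⊕ ℕ)) : slots (.inl x :: l) = slots l := by
  simp [slots]
@[simp] theorem slots_inr (c : ℕ) (l : List (𝕜 ⊕ ℕ)) : slots (.inr c :: l) = slots l + 1 := by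
  rw [slots, List.countP_cons_of_pos rfl, slots]
@[simp] theorem slots_append (l l' : List (𝕜 ⊕ ℕ)) : slots (l ++ l') = slots l + slots l' := by
  simp [slots]

variable [CommRing 𝕜] (r : ℕ) (L : ℕ → ℕ → 𝕜)

/-- The entry with code `z` of the table of one coloring of weight code `w`. The list describes the
pairs of vertices: a pair outside the cut contributes a factor (`inl`), while an edge of the
cut (`inr`, with the color of its left end) contributes the entry of `L` selected by its own base
`r` digit of `z`. What remains of `z` above these digits has to be the weight code. -/
def tval (w : ℕ) : List (𝕜 ⊕ ℕ) → ℕ → 𝕜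
  | [], z => if w = z then 1 else 0
  | .inl x :: l, z => x * tval w l z
  | .inr c :: l, z => L c (z % r) * tval w l (z / r)

variable {r L}

/-- Increasing the weight code shifts the table. -/
theorem tval_add (hr : 0 < r) (w δ : ℕ) (l : List (𝕜 ⊕ ℕ)) (z : ℕ) :
    tval r L (w + δ) l z =
      if z < δ * r ^ slots l then 0 else tval r L w l (z - δ * r ^ slots l) := by
  induction l generalizing z with
  | nil =>
    simp only [tval, slots_nil, pow_zero, mul_one]
    split_ifs <;> first | rfl | omega
  | cons a l ih =>
    cases a with
    | inl x =>
      simp only [tval, ih, slots_inl]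
      split_ifs <;> simp
    | inr c =>
      have e : δ * r ^ (slots l + 1) = r * (δ * r ^ slots l) := by ring
      simp only [tval, ih, slots_inr, e, Nat.div_lt_iff_lt_mul hr, mul_comm _ r]
      split_ifs with h
      · simp
      · rw [Nat.sub_mul_mod (not_lt.1 h), Nat.sub_mul_div]

/-- A factor can be pulled out from every place of the list. -/
theorem tval_inl (w : ℕ) (pre post : List (𝕜 ⊕ ℕ)) (x : 𝕜) (z : ℕ) :
    tval r L w (pre ++ .inl x :: post) z = x * tval r L w (pre ++ post) z := by
  induction pre generalizing z with
  | nil => rfl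
  | cons a l ih =>
    cases a <;> simp only [List.cons_append, tval, ih] <;> ring

/-- Reading off the digit in the middle of a code. -/
theorem tval_inr (hr : 0 < r) (w : ℕ) (pre post : List (𝕜 ⊕ ℕ)) (c z : ℕ) :
    tval r L w (pre ++ .inr c :: post) z = L c (z / r ^ slots pre % r) *
      tval r L w (pre ++ post) (z / (r ^ slots pre * r) * r ^ slots pre + z % r ^ slots pre) := by
  induction pre generalizing z with
  | nil => simp [tval, Nat.mod_one]
  | cons a l ih =>
    cases a with
    | inl x =>
      simp only [List.cons_append, tval, ih, slots_inl]
      ring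
    | inr c' =>
      simp only [List.cons_append, tval, ih, slots_inr]
      set B := r ^ slots l with hB
      have hB0 : 0 < B := by positivity
      have e1 : z / r / B = z / r ^ (slots l + 1) := by
        rw [Nat.div_div_eq_div_mul, pow_succ, mul_comm]
      have e2 : (z / (r ^ (slots l + 1) * r) * r ^ (slots l + 1) + z % r ^ (slots l + 1)) % r
          = z % r := by
        rw [pow_succ, ← mul_assoc, Nat.mul_add_mod_self_right, Nat.mod_mul_left_mod]
      have e3 : (z / (r ^ (slots l + 1) * r) * r ^ (slots l + 1) + z % r ^ (slots l + 1)) / r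
          = z / r / (B * r) * B + z / r % B := by
        rw [pow_succ, ← mul_assoc, add_comm, Nat.add_mul_div_right _ _ hr, add_comm,
          mul_comm (r ^ slots l) r, Nat.mod_mul_right_div_self, Nat.div_div_eq_div_mul]
        simp only [← hB, mul_assoc]
        rw [mul_comm B r]
      rw [e1, e2, e3]
      ring

/-- Summing over the lowest digit, with the matrix `R`, replaces the edge by its matrix entry. -/
theorem sum_tval_mul (hr : 0 < r) (w : ℕ) (pre post : List (𝕜 ⊕ ℕ)) (hpre : slots pre = 0)
    (c z : ℕ) (f : ℕ → 𝕜) :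
    ∑ d ∈ Finset.range r, tval r L w (pre ++ .inr c :: post) (z * r + d) * f d =
      (∑ d ∈ Finset.range r, L c d * f d) * tval r L w (pre ++ post) z := by
  rw [Finset.sum_mul]
  refine Finset.sum_congr rfl fun d hd => ?_
  have hd := Finset.mem_range.1 hd
  rw [tval_inr hr, hpre, pow_zero, Nat.div_one, one_mul, mul_one, Nat.mod_one, add_zero,
    Nat.mul_add_mod_self_right, Nat.mod_eq_of_lt hd, add_comm, Nat.add_mul_div_right _ _ hr,
    Nat.div_eq_of_lt hd, zero_add]
  ring

end Tval

/-! ### Partial colorings -/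

section Colorings

variable {𝕜 : Type*} [CommRing 𝕜]

/-- The sum of `f` over all colorings of the vertices `0, …, i - 1` with colors below `C`; all
other vertices get color `0`. -/
def sumCol (C : ℕ) : ℕ → ((ℕ → ℕ) → 𝕜) → 𝕜
  | 0, f => f fun _ => 0
  | i + 1, f => ∑ c ∈ Finset.range C, sumCol C i fun col => f (Function.update col i c)

theorem sumCol_mul_left (C i : ℕ) (x : 𝕜) (f : (ℕ → ℕ) → 𝕜) :
    sumCol C i (fun col => x * f col) = x * sumCol C i f := by
  induction i generalizing f with
  | zero => rfl
  | succ i ih => simp only [sumCol, ih, Finset.mul_sum]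

theorem sumCol_zero (C i : ℕ) : sumCol C i (fun _ => (0 : 𝕜)) = 0 := by
  simpa using sumCol_mul_left C i (0 : 𝕜) fun _ => 0

theorem sumCol_sum {ι : Type*} (C i : ℕ) (s : Finset ι) (f : ι → (ℕ → ℕ) → 𝕜) :
    sumCol C i (fun col => ∑ d ∈ s, f d col) = ∑ d ∈ s, sumCol C i (f d) := by
  induction i generalizing f with
  | zero => rfl
  | succ i ih =>
    simp only [sumCol, ih]
    exact Finset.sum_comm

/-- A coloring of an initial segment, extended by color `0`. -/
def extend {C i : ℕ} (g : Fin i → Fin C) (t : ℕ) : ℕ := if h : t < i then g ⟨t, h⟩ else 0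

theorem sumCol_eq_sum (C i : ℕ) (f : (ℕ → ℕ) → 𝕜) :
    sumCol C i f = ∑ g : Fin i → Fin C, f (extend g) := by
  induction i generalizing f with
  | zero =>
    rw [Fintype.sum_unique]
    rfl
  | succ i ih =>
    rw [← (Fin.snocEquiv fun _ => Fin C).sum_comp, Fintype.sum_prod_type, sumCol,
      ← Fin.sum_univ_eq_sum_range fun c => sumCol C i fun col => f (Function.update col i c)]
    refine Finset.sum_congr rfl fun c _ => ?_
    rw [ih]
    refine Finset.sum_congr rfl fun g _ => congrArg f ?_
    funext t
    rcases lt_trichotomy t i with h | h | h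
    · rw [Function.update_of_ne h.ne]
      simp [extend, h, h.trans (Nat.lt_succ_self i), Fin.snocEquiv, Fin.snoc]
    · subst h
      simp [extend, Fin.snocEquiv, Fin.snoc]
    · rw [Function.update_of_ne h.ne']
      simp [extend, h.not_gt, show ¬ t < i + 1 by omega]

end Colorings

/-! ### The tables of the dynamic program -/

/-- The data of the dynamic program. Vertices are the positions `0, …, n - 1` of the arrangement,
colors are numbers below `C`, and a pair of positions `(u, w)` has the number `w * n + u`. The
matrix `M` is the product of `L`, with `r` columns, and `R`; the number `δ t c` is the contribution
of color `c` at position `t` to the weight code. -/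
structure Network (𝕜 : Type*) [CommRing 𝕜] where
  n : ℕ
  C : ℕ
  r : ℕ
  r_pos : 0 < r
  E : ℕ → ℕ → Prop
  allowed : ℕ → ℕ → Prop
  δ : ℕ → ℕ → ℕ
  L : ℕ → ℕ → 𝕜
  R : ℕ → ℕ → 𝕜
  M : ℕ → ℕ → 𝕜
  mul_eq : ∀ c c', ∑ d ∈ Finset.range r, L c d * R d c' = M c c'

namespace Network

variable {𝕜 : Type*} [CommRing 𝕜] (D : Network 𝕜)

/-- The pair number `q` is an edge from the first `i` positions to the other ones. -/
def Cross (i q : ℕ) : Prop := D.E (q % D.n) (q / D.n) ∧ q % D.n < i ∧ i ≤ q / D.n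

open Classical in
/-- The contribution of pair number `q` when the first `i` positions are processed. -/
noncomputable def item (i : ℕ) (col : ℕ → ℕ) (q : ℕ) : 𝕜 ⊕ ℕ :=
  if D.E (q % D.n) (q / D.n) ∧ q % D.n < q / D.n ∧ q % D.n < i then
    if q / D.n < i then .inl (D.M (col (q % D.n)) (col (q / D.n))) else .inr (col (q % D.n))
  else .inl 1

/-- The contributions of all pairs while position `i` is processed: the first `q` pairs have already
been treated. -/
noncomputable def stage (i q : ℕ) (col : ℕ → ℕ) : List (𝕜 ⊕ ℕ) :=
  (List.range q).map (D.item (i + 1) col) ++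
    (List.range' q (D.n * D.n - q)).map (D.item i col)

open Classical in
/-- Whether the first `i` positions have allowed colors. -/
noncomputable def listFactor (i : ℕ) (col : ℕ → ℕ) : 𝕜 :=
  ∏ t ∈ Finset.range i, if D.allowed t (col t) then 1 else 0

/-- The weight code of the first `i` positions. -/
def weight (i : ℕ) (col : ℕ → ℕ) : ℕ := ∑ t ∈ Finset.range i, D.δ t (col t)

/-- The table after `i` positions. -/
noncomputable def table (i z : ℕ) : 𝕜 :=
  sumCol D.C i fun col => D.listFactor i col * tval D.r D.L (D.weight i col) (D.stage i 0 col) z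

/-- The table while position `i`, which has color `c`, is processed. -/
noncomputable def colorTable (i q c z : ℕ) : 𝕜 :=
  sumCol D.C i fun col => D.listFactor (i + 1) (Function.update col i c) *
    tval D.r D.L (D.weight (i + 1) (Function.update col i c))
      (D.stage i q (Function.update col i c)) z

open Classical in
/-- The number of edges among the first `q` pairs that leave the first `i` positions. -/
noncomputable def crossBelow (i q : ℕ) : ℕ := (List.range q).countP fun q => D.Cross i q

open Classical in
/-- The number of digits used at a stage. -/
noncomputable def digits (i q : ℕ) : ℕ :=
  D.crossBelow (i + 1) q + (List.range' q (D.n * D.n - q)).countP fun q => D.Cross i q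

theorem slots_map_item (i : ℕ) (col : ℕ → ℕ) (l : List ℕ) [DecidablePred (D.Cross i)] :
    slots (l.map (D.item i col)) = l.countP fun q => D.Cross i q := by
  rw [slots, List.countP_map]
  refine List.countP_congr fun q _ => ?_
  rw [Function.comp, decide_eq_true_eq, item, Cross]
  split_ifs with h1 h2
  · exact ⟨fun h => (nomatch h), fun h => by omega⟩
  · exact ⟨fun _ => ⟨h1.1, h1.2.2, by omega⟩, fun _ => rfl⟩
  · exact ⟨fun h => (nomatch h), fun h => absurd ⟨h.1, by omega, h.2.1⟩ h1⟩

theorem slots_range (i q : ℕ) (col : ℕ → ℕ) :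
    slots ((List.range q).map (D.item i col)) = D.crossBelow i q := by
  classical
  rw [slots_map_item, crossBelow]

theorem slots_stage (i q : ℕ) (col : ℕ → ℕ) : slots (D.stage i q col) = D.digits i q := by
  classical
  rw [stage, slots_append, slots_range, slots_map_item, digits]

variable {D}

theorem item_update {i k q c : ℕ} (h : i ≤ k) (col : ℕ → ℕ) :
    D.item i (Function.update col k c) q = D.item i col q := by
  unfold item
  split_ifs with h1 h2
  · rw [Function.update_of_ne (by omega), Function.update_of_ne (by omega)]
  · rw [Function.update_of_ne (by omega)]
  · rfl

theorem table_succ (i z : ℕ) :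
    D.table (i + 1) z = ∑ c ∈ Finset.range D.C, D.colorTable i (D.n * D.n) c z := by
  simp only [table, colorTable, sumCol, stage]
  simp [List.range_eq_range']

theorem table_zero (z : ℕ) : D.table 0 z = if z = 0 then 1 else 0 := by
  have h : ∀ (l : List ℕ) (col : ℕ → ℕ), tval D.r D.L 0 (l.map (D.item 0 col)) z
      = if z = 0 then 1 else 0 := by
    intro l col
    induction l with
    | nil => simp [tval, eq_comm]
    | cons a l ih => simp [tval, item, ih]
  simp [table, sumCol, listFactor, weight, stage, h]

open Classical in
/-- Introducing a vertex of color `c`. -/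
theorem colorTable_zero (i c z : ℕ) :
    D.colorTable i 0 c z = (if D.allowed i c then 1 else 0) *
      if z < D.δ i c * D.r ^ D.digits i 0 then 0
      else D.table i (z - D.δ i c * D.r ^ D.digits i 0) := by
  have h1 : ∀ col : ℕ → ℕ, D.listFactor (i + 1) (Function.update col i c) =
      (if D.allowed i c then 1 else 0) * D.listFactor i col := by
    intro col
    rw [listFactor, Finset.prod_range_succ, Function.update_self, mul_comm, listFactor]
    refine congrArg _ (Finset.prod_congr rfl fun t ht => ?_)
    rw [Function.update_of_ne (Finset.mem_range.1 ht).ne]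
  have h2 : ∀ col : ℕ → ℕ, D.weight (i + 1) (Function.update col i c) =
      D.weight i col + D.δ i c := by
    intro col
    rw [weight, Finset.sum_range_succ, Function.update_self, weight]
    refine congrArg (· + _) (Finset.sum_congr rfl fun t ht => ?_)
    rw [Function.update_of_ne (Finset.mem_range.1 ht).ne]
  have h3 : ∀ col : ℕ → ℕ, D.stage i 0 (Function.update col i c) = D.stage i 0 col := by
    intro col
    simp [stage, item_update]
  simp only [colorTable, h1, h2, h3, tval_add D.r_pos, slots_stage, mul_assoc, sumCol_mul_left]
  split_ifs with h4 h5 <;> simp [sumCol_zero, table]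

variable {i q : ℕ}

theorem stage_eq (hq : q < D.n * D.n) (col : ℕ → ℕ) :
    D.stage i q col = (List.range q).map (D.item (i + 1) col) ++ D.item i col q ::
      (List.range' (q + 1) (D.n * D.n - (q + 1))).map (D.item i col) := by
  rw [stage, show D.n * D.n - q = D.n * D.n - (q + 1) + 1 by omega, List.range'_succ, List.map_cons]

theorem stage_succ_eq (col : ℕ → ℕ) :
    D.stage i (q + 1) col = (List.range q).map (D.item (i + 1) col) ++ D.item (i + 1) col q ::
      (List.range' (q + 1) (D.n * D.n - (q + 1))).map (D.item i col) := by
  rw [stage, List.range_succ, List.map_append]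
  simp

/-- A pair that is not an edge, or an edge without an end in position `i`. -/
theorem colorTable_succ_of_item_eq (hq : q < D.n * D.n)
    (h : ∀ col, D.item (i + 1) col q = D.item i col q) (c z : ℕ) :
    D.colorTable i (q + 1) c z = D.colorTable i q c z := by
  simp only [colorTable, stage_eq hq, stage_succ_eq, h]

theorem digits_of_item_eq (hq : q < D.n * D.n)
    (h : ∀ col, D.item (i + 1) col q = D.item i col q) : D.digits i (q + 1) = D.digits i q := by
  rw [← slots_stage _ _ _ id, ← slots_stage _ _ _ id, stage_eq hq, stage_succ_eq, h]

/-- An edge whose right end is position `i`. -/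
theorem colorTable_succ_right (hq : q < D.n * D.n) (h1 : D.E (q % D.n) (q / D.n))
    (h2 : q % D.n < i) (h3 : q / D.n = i) (h4 : D.crossBelow (i + 1) q = 0) (c z : ℕ) :
    D.colorTable i (q + 1) c z =
      ∑ d ∈ Finset.range D.r, D.colorTable i q c (z * D.r + d) * D.R d c := by
  have e1 : ∀ col, D.item i col q = .inr (col (q % D.n)) := by
    intro col
    rw [item, if_pos ⟨h1, by omega, h2⟩, if_neg (by omega)]
  have e2 : ∀ col, D.item (i + 1) col q = .inl (D.M (col (q % D.n)) (col i)) := by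
    intro col
    rw [item, if_pos ⟨h1, by omega, by omega⟩, if_pos (by omega), h3]
  simp only [colorTable, stage_eq hq, stage_succ_eq, e1, e2, tval_inl, Function.update_self]
  simp only [← D.mul_eq, ← sum_tval_mul D.r_pos _ _ _ ((D.slots_range _ _ _).trans h4)]
  simp only [mul_comm _ (D.R _ c), ← sumCol_mul_left, ← sumCol_sum, Finset.mul_sum,
    mul_left_comm (D.R _ c)]

theorem digits_right (hq : q < D.n * D.n) (h1 : D.E (q % D.n) (q / D.n))
    (h2 : q % D.n < i) (h3 : q / D.n = i) : D.digits i (q + 1) + 1 = D.digits i q := by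
  rw [← slots_stage _ _ _ id, ← slots_stage _ _ _ id, stage_eq hq, stage_succ_eq]
  rw [item, if_pos ⟨h1, by omega, by omega⟩, if_pos (by omega)]
  rw [item, if_pos ⟨h1, by omega, by omega⟩, if_neg (by omega)]
  simp
  omega

/-- An edge whose left end is position `i`. -/
theorem colorTable_succ_left (hq : q < D.n * D.n) (h1 : D.E (q % D.n) (q / D.n))
    (h2 : q % D.n = i) (h3 : i < q / D.n) (c z : ℕ) :
    D.colorTable i (q + 1) c z =
      D.L c (z / D.r ^ D.crossBelow (i + 1) q % D.r) *
      D.colorTable i q c (z / (D.r ^ D.crossBelow (i + 1) q * D.r) * D.r ^ D.crossBelow (i + 1) q +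
        z % D.r ^ D.crossBelow (i + 1) q) := by
  have e1 : ∀ col, D.item i col q = .inl 1 := by
    intro col
    rw [item, if_neg (by omega)]
  have e2 : ∀ col, D.item (i + 1) col q = .inr (col i) := by
    intro col
    rw [item, if_pos ⟨h1, by omega, by omega⟩, if_neg (by omega), h2]
  simp only [colorTable, stage_eq hq, stage_succ_eq, e1, e2, tval_inl, Function.update_self,
    tval_inr D.r_pos, slots_range, one_mul, ← sumCol_mul_left, mul_left_comm (D.L c _)]

theorem digits_left (hq : q < D.n * D.n) (h1 : D.E (q % D.n) (q / D.n))
    (h2 : q % D.n = i) (h3 : i < q / D.n) : D.digits i (q + 1) = D.digits i q + 1 := by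
  rw [← slots_stage _ _ _ id, ← slots_stage _ _ _ id, stage_eq hq, stage_succ_eq]
  rw [item, if_pos ⟨h1, by omega, by omega⟩, if_neg (by omega)]
  rw [item, if_neg (by omega)]
  simp
  omega

open Classical in
theorem crossBelow_succ : D.crossBelow i (q + 1) =
    D.crossBelow i q + if D.Cross i q then 1 else 0 := by
  simp [crossBelow, List.range_succ, List.countP_singleton]

/-- Pairs with right position below `i` do not cross the cut after the first `i` positions. -/
theorem crossBelow_eq_zero (hq : q ≤ i * D.n) : D.crossBelow i q = 0 := by
  classical
  rw [crossBelow, List.countP_eq_zero]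
  intro a ha
  have ha := List.mem_range.1 ha
  have : a / D.n < i := Nat.div_lt_of_lt_mul (by rw [mul_comm]; omega)
  rw [decide_eq_true_eq, Cross]
  omega

/-- No stage uses more digits than the larger of the two cuts. This is due to the numbering of the
pairs by right positions first: as long as pairs with right position at most `i` are treated, no
new digit has appeared, and afterwards all edges that still have an old digit belong to the new
cut. -/
theorem digits_le (hq : q ≤ D.n * D.n) :
    D.digits i q ≤ max (D.crossBelow i (D.n * D.n)) (D.crossBelow (i + 1) (D.n * D.n)) := by
  classical
  have hsplit : List.range (D.n * D.n) = List.range q ++ List.range' q (D.n * D.n - q) := by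
    have := List.range'_append_1 (s := 0) (m := q) (n := D.n * D.n - q)
    rw [List.range_eq_range', List.range_eq_range', ← Nat.add_sub_cancel' hq, ← this]
    simp
  rcases le_total q ((i + 1) * D.n) with h | h
  · refine le_max_of_le_left ?_
    rw [digits, crossBelow_eq_zero h, crossBelow, hsplit, List.countP_append]
    omega
  · refine le_max_of_le_right ?_
    rw [digits, crossBelow, crossBelow, hsplit, List.countP_append]
    refine Nat.add_le_add_left (List.countP_mono_left fun a ha => ?_) _
    have ha := (List.mem_range'_1.1 ha).1
    rcases Nat.eq_zero_or_pos D.n with h0 | h0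
    · simp [Cross, h0]
      intros; omega
    have : i + 1 ≤ a / D.n := (Nat.le_div_iff_mul_le h0).2 (by omega)
    rw [decide_eq_true_eq, decide_eq_true_eq]
    exact fun hc => ⟨hc.1, hc.2.1.trans (Nat.lt_succ_self i), this⟩

end Network

/-! ### The program -/

open RAM

theorem Network.digits_zero {𝕜 : Type*} [CommRing 𝕜] (D : Network 𝕜) (i : ℕ) :
    D.digits i 0 = D.crossBelow i (D.n * D.n) := by
  simp [Network.digits, Network.crossBelow, List.range_eq_range']

theorem Network.digits_last {𝕜 : Type*} [CommRing 𝕜] (D : Network 𝕜) (i : ℕ) :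
    D.digits i (D.n * D.n) = D.digits (i + 1) 0 := by
  rw [D.digits_zero]
  simp [Network.digits]

/-- The parts of the program that depend on the coloring-like problem: number of colors, rank,
indicator of the special colors, factors of the consistency matrix, and the coefficients of
`C ^ n` and `1` in the modulus and in the scaling factor of the matrix product. -/
structure Params where
  C : ℕ
  r : ℕ
  special : ℕ → ℤ
  L : ℕ → ℕ → ℤ
  R : ℕ → ℕ → ℤ
  modCoeff : ℤ × ℤ
  scaleCoeff : ℤ × ℤ

namespace Params

variable (p : Params)

/-! Variables: arrays `0` to `4` contain the input, array `5` the modulus, `6` the scaling factor,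
`7` the number of weight codes, `8` the multiplier in weight codes, `10` the table between two
vertices, `11` the table of the current vertex (with the color as lowest digit of the address), `12`
the counter of a sweep, `13` the current position, `14` the number of the current pair, `15` the
number of digit combinations, `16` the place value of the current pair, and `17` powers of the
number of colors. -/

/-- Entry of the adjacency matrix for two positions. -/
def adj (u w : Term) : Term := .load 3 (.load 1 u * var 0 + .load 1 w)

/-- The number of cells of the table of the current vertex. -/
def cells : Term := var 15 * var 7 * .const p.C

/-- Start the table of the current vertex: shift by the weight of the vertex. -/
def introduce : Prog :=
  sweepUp 12 11 p.cells (.load 4 (.load 1 (var 13) * .const p.C + var 12 % .const p.C) *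
    .load 10 (var 12 / .const p.C - Term.table p.C p.special (var 12 % .const p.C) *
      (var 8 + .load 2 (.load 1 (var 13))) * var 15))

/-- Sum over the lowest digit. -/
def contract : Prog :=
  sweepUp 12 11 p.cells (Term.sum ((List.range p.r).map fun d : ℕ =>
    .load 11 ((var 12 / .const p.C * .const p.r + .const d) * .const p.C + var 12 % .const p.C) *
      Term.table p.C (p.R d) (var 12 % .const p.C)) % var 5)

/-- Insert a new digit. -/
def expand : Prog :=
  sweepDown 12 11 p.cells (.load 11 ((var 12 / .const p.C / (var 16 * .const p.r) * var 16 +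
      var 12 / .const p.C % var 16) * .const p.C + var 12 % .const p.C) *
    (var 6 * Term.matrix p.C p.r p.L (var 12 % .const p.C)
      (var 12 / .const p.C / var 16 % .const p.r)) % var 5)

/-- Sum over the color of the current vertex. -/
def collect : Prog :=
  sweepUp 12 10 (var 15 * var 7) (Term.sum ((List.range p.C).map fun c : ℕ =>
    .load 11 (var 12 * .const p.C + .const c)) % var 5)

/-- The left position of the current pair. -/
def left : Term := var 14 % var 0

/-- The right position of the current pair. -/
def right : Term := var 14 / var 0

/-- Treat the current pair. -/
def pairStep : Prog :=
  .cond (adj left right * left.lt right)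
    (.cond (right.eq (var 13))
      (.seq (.store 15 (.const 0) (var 15 / .const p.r)) p.contract)
      (.cond (left.eq (var 13))
        (.seq (.store 15 (.const 0) (var 15 * .const p.r))
          (.seq p.expand (.store 16 (.const 0) (var 16 * .const p.r))))
        (.cond (left.lt (var 13) * (var 13).lt right)
          (.store 16 (.const 0) (var 16 * .const p.r))
          .nop)))
    .nop

/-- Treat all pairs. -/
def pairLoop : Prog :=
  .loop ((var 14).lt (var 0 * var 0))
    (.seq p.pairStep (.store 14 (.const 0) (var 14 + .const 1)))

/-- Process the current vertex. -/
def vertexStep : Prog :=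
  .seq p.introduce (.seq (.store 16 (.const 0) (.const 1)) (.seq (.store 14 (.const 0) (.const 0))
    (.seq p.pairLoop (.seq p.collect (.store 13 (.const 0) (var 13 + .const 1))))))

/-- Process all vertices. -/
def vertexLoop : Prog := .loop ((var 13).lt (var 0)) p.vertexStep

end Params

/-! ### Correctness and running time of the dynamic program -/

section Verification

variable {m : ℕ}

/-- The part of the memory that does not change during the dynamic program. -/
structure Env (p : Params) (D : Network (ZMod m)) (lam : ℤ) (S : ℕ) (σ : Memory) : Prop where
  n : σ 0 0 = D.n
  mod : σ 5 0 = m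
  lam : σ 6 0 = lam
  S : σ 7 0 = S
  adj_one : ∀ u < D.n, ∀ w < D.n, D.E u w → σ 3 (σ 1 u * σ 0 0 + σ 1 w) = 1
  adj_zero : ∀ u < D.n, ∀ w < D.n, ¬ D.E u w → σ 3 (σ 1 u * σ 0 0 + σ 1 w) = 0
  list_one : ∀ t < D.n, ∀ c < D.C, D.allowed t c → σ 4 (σ 1 t * D.C + c) = 1
  list_zero : ∀ t < D.n, ∀ c < D.C, ¬ D.allowed t c → σ 4 (σ 1 t * D.C + c) = 0
  shift : ∀ t < D.n, ∀ c < D.C, p.special c * (σ 8 0 + σ 2 (σ 1 t)) = D.δ t c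

theorem Env.congr {p : Params} {D : Network (ZMod m)} {lam : ℤ} {S : ℕ} {σ τ : Memory}
    (h : Env p D lam S σ) (hτ : ∀ k < 9, τ k = σ k) : Env p D lam S τ := by
  constructor <;> simp only [hτ _ (show 0 < 9 by omega), hτ _ (show 1 < 9 by omega),
    hτ _ (show 2 < 9 by omega), hτ _ (show 3 < 9 by omega), hτ _ (show 4 < 9 by omega),
    hτ _ (show 5 < 9 by omega), hτ _ (show 6 < 9 by omega), hτ _ (show 7 < 9 by omega),
    hτ _ (show 8 < 9 by omega)]
  exacts [h.n, h.mod, h.lam, h.S, h.adj_one, h.adj_zero, h.list_one, h.list_zero, h.shift]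

/-- The program parameters belong to the network, and `V` and `W` bound all numbers and the
number of cells of a table. -/
structure Fits (p : Params) (D : Network (ZMod m)) (lam : ℤ) (S V W : ℕ) : Prop where
  C_eq : p.C = D.C
  r_eq : p.r = D.r
  L_eq : ∀ c < D.C, ∀ d < D.r, ((lam * p.L c d : ℤ) : ZMod m) = D.L c d
  R_eq : ∀ d < D.r, ∀ c < D.C, (p.R d c : ZMod m) = D.R d c
  C_pos : 0 < D.C
  m_pos : 0 < m
  S_pos : 0 < S
  m_le : m ≤ V
  W_le : W ≤ V
  n_le : D.n * D.n ≤ V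
  cells_le : ∀ i < D.n, ∀ q ≤ D.n * D.n, D.r ^ D.digits i q * S * D.C ≤ W

/-- The state before position `i` is processed. -/
structure VertexInv (p : Params) (D : Network (ZMod m)) (lam : ℤ) (S V : ℕ) (i : ℕ) (σ : Memory) :
    Prop where
  bounded : Bounded V σ
  env : Env p D lam S σ
  pos : σ 13 0 = i
  count : σ 15 0 = ((D.r ^ D.digits i 0 : ℕ) : ℤ)
  neg : ∀ z < 0, σ 10 z = 0
  table : ∀ z < D.r ^ D.digits i 0 * S, (σ 10 z : ZMod m) = D.table i z

/-- The state while position `i` is processed, before pair number `q` is treated. -/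
structure PairInv (p : Params) (D : Network (ZMod m)) (lam : ℤ) (S V : ℕ) (i q : ℕ) (σ : Memory) :
    Prop where
  bounded : Bounded V σ
  env : Env p D lam S σ
  pos : σ 13 0 = i
  count : σ 15 0 = ((D.r ^ D.digits i q : ℕ) : ℤ)
  place : σ 16 0 = ((D.r ^ D.crossBelow (i + 1) q : ℕ) : ℤ)
  neg : ∀ z < 0, σ 10 z = 0
  table : ∀ a < D.r ^ D.digits i q * S * D.C,
    (σ 11 a : ZMod m) = D.colorTable i q (a % D.C) (a / D.C)

variable {p : Params} {D : Network (ZMod m)} {lam : ℤ} {S V W X i q : ℕ} {σ : Memory}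

theorem natAbs_emod_le (hm : 0 < m) (hV : m ≤ V) (x : ℤ) : (x % (m : ℤ)).natAbs ≤ V := by
  have h1 := Int.emod_nonneg x (show (m : ℤ) ≠ 0 by omega)
  have h2 := Int.emod_lt_of_pos x (show (0 : ℤ) < m by omega)
  omega

theorem mul_add_div_of_lt {a b c : ℕ} (h : c < b) : (a * b + c) / b = a := by
  rw [add_comm, Nat.add_mul_div_right _ _ (Nat.zero_lt_of_lt h), Nat.div_eq_of_lt h, zero_add]

/-- Starting the table of a vertex. Where the shifted address is negative, the memory contains the
value `0` that is required. -/
theorem VertexInv.introduce (F : Fits p D lam S V W) (hX : width V ^ 2 ≤ X) (hi : i < D.n)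
    (h : VertexInv p D lam S V i σ) :
    Does (X * (W + 1)) σ p.introduce fun τ => Bounded V τ ∧ Env p D lam S τ ∧ τ 13 0 = i ∧
      τ 15 0 = ((D.r ^ D.digits i 0 : ℕ) : ℤ) ∧ (∀ z < 0, τ 10 z = 0) ∧
      ∀ a < D.r ^ D.digits i 0 * S * D.C,
        (τ 11 a : ZMod m) = D.colorTable i 0 (a % D.C) (a / D.C) := by
  have hcW := F.cells_le i hi 0 (Nat.zero_le _)
  refine does_sweepUp (m := m) (fun a => D.colorTable i 0 (a % D.C) (a / D.C)) h.bounded hX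
    (by decide) (hcW.trans F.W_le) hcW ?_ ?_ ?_
  · intro τ hτ
    simp only [Params.cells, Term.eval_mul, eval_var, Term.eval_const, F.C_eq]
    rw [hτ 15 (by decide) (by decide), hτ 7 (by decide) (by decide), h.count, h.env.S]
    push_cast
    rfl
  · intro a ha τ hτ hch hτa
    have henv := h.env.congr (τ := τ) fun k hk => hch.1 k (by omega) (by omega)
    have h13 : τ 13 0 = i := by rw [hch.1 13 (by decide) (by decide), h.pos]
    have h15 : τ 15 0 = ((D.r ^ D.digits i 0 : ℕ) : ℤ) := by
      rw [hch.1 15 (by decide) (by decide), h.count]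
    have hc : a % D.C < D.C := Nat.mod_lt _ F.C_pos
    have hz : a / D.C < D.r ^ D.digits i 0 * S := Nat.div_lt_of_lt_mul (by rwa [mul_comm])
    have hx : (var 12 % Term.const (p.C : ℤ)).eval τ = ((a % D.C : ℕ) : ℤ) := by
      simp [hτa, F.C_eq]
    have htab := Term.eval_table p.special hx (hc.trans_eq F.C_eq.symm)
    rw [F.C_eq] at hx htab
    simp only [Term.eval_mul, Term.eval_load, Term.eval_sub, Term.eval_add, eval_var,
      Term.eval_div, Term.eval_const, htab, hx, h13, h15, hτa, F.C_eq]
    rw [henv.shift i hi _ hc, hch.1 10 (by decide) (by decide), D.colorTable_zero]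
    by_cases hl : D.allowed i (a % D.C)
    · rw [henv.list_one i hi _ hc hl, one_mul, if_pos hl, one_mul]
      refine ⟨h.bounded _ _, ?_⟩
      split_ifs with hs
      · rw [h.neg]
        · simp
        · zify at hs; push_cast; linarith
      · rw [← h.table _ (lt_of_le_of_lt (Nat.sub_le _ _) hz)]
        push_cast [not_lt.1 hs]
        rfl
    · rw [henv.list_zero i hi _ hc hl, zero_mul, if_neg hl, zero_mul]
      simp
  · intro τ hτ hch hF
    refine ⟨hτ, h.env.congr (τ := τ) fun k hk => hch.1 k (by omega) (by omega), ?_, ?_, ?_, hF⟩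
    · rw [hch.1 13 (by decide) (by decide), h.pos]
    · rw [hch.1 15 (by decide) (by decide), h.count]
    · rw [hch.1 10 (by decide) (by decide)]
      exact h.neg

/-- The cells read for cell `a` have addresses at least `a`, so an ascending sweep can work in
place. -/
theorem does_contract (F : Fits p D lam S V W) (hX : width V ^ 2 ≤ X) (hi : i < D.n)
    (hq : q < D.n * D.n) (hb : Bounded V σ) (he : Env p D lam S σ)
    (h15 : σ 15 0 = ((D.r ^ D.digits i (q + 1) : ℕ) : ℤ))
    (hd : D.digits i (q + 1) + 1 = D.digits i q)
    (ht : ∀ a < D.r ^ D.digits i q * S * D.C,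
      (σ 11 a : ZMod m) = D.colorTable i q (a % D.C) (a / D.C))
    (hstep : ∀ c z, D.colorTable i (q + 1) c z =
      ∑ d ∈ Finset.range D.r, D.colorTable i q c (z * D.r + d) * D.R d c) :
    Does (X * (W + 1)) σ p.contract fun τ => Bounded V τ ∧
      (∀ k, k ≠ 12 → k ≠ 11 → τ k = σ k) ∧
      ∀ a < D.r ^ D.digits i (q + 1) * S * D.C,
        (τ 11 a : ZMod m) = D.colorTable i (q + 1) (a % D.C) (a / D.C) := by
  have hcW := F.cells_le i hi (q + 1) hq
  refine does_sweepUp (m := m) (fun a => D.colorTable i (q + 1) (a % D.C) (a / D.C)) hb hX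
    (by decide) (hcW.trans F.W_le) hcW ?_ ?_ fun τ hτ hch hF => ⟨hτ, hch.1, hF⟩
  · intro τ hτ
    simp only [Params.cells, Term.eval_mul, eval_var, Term.eval_const, F.C_eq]
    rw [hτ 15 (by decide) (by decide), hτ 7 (by decide) (by decide), h15, he.S]
    push_cast
    rfl
  · intro a ha τ hτ hch hτa
    have henv := he.congr (τ := τ) fun k hk => hch.1 k (by omega) (by omega)
    have hc : a % D.C < D.C := Nat.mod_lt _ F.C_pos
    have hz : a / D.C < D.r ^ D.digits i (q + 1) * S := Nat.div_lt_of_lt_mul (by rwa [mul_comm])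
    have hx : (var 12 % Term.const (p.C : ℤ)).eval τ = ((a % D.C : ℕ) : ℤ) := by
      simp [hτa, F.C_eq]
    rw [Term.eval_mod, eval_var, henv.mod]
    refine ⟨natAbs_emod_le F.m_pos F.m_le _, ?_⟩
    rw [ZMod.intCast_mod, hstep, Term.eval_sum_range, Int.cast_sum, F.r_eq]
    refine Finset.sum_congr rfl fun d hd' => ?_
    have hd' := Finset.mem_range.1 hd'
    have htab := Term.eval_table (p.R d) hx (hc.trans_eq F.C_eq.symm)
    rw [F.C_eq] at hx htab
    simp only [Term.eval_mul, Term.eval_load, Term.eval_add, eval_var,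
      Term.eval_div, Term.eval_const, htab, hx, hτa, F.C_eq]
    rw [Int.cast_mul, F.R_eq d hd' _ hc]
    refine congrArg (· * _) ?_
    have e : ((a : ℤ) / D.C * D.r + d) * D.C + ((a % D.C : ℕ) : ℤ) =
        (((a / D.C * D.r + d) * D.C + a % D.C : ℕ) : ℤ) := by push_cast; rfl
    have h1 : a / D.C * D.r + d < D.r ^ D.digits i q * S := by
      rw [← hd, pow_succ]
      calc a / D.C * D.r + d < (a / D.C + 1) * D.r := by rw [add_mul]; omega
        _ ≤ (D.r ^ D.digits i (q + 1) * S) * D.r := Nat.mul_le_mul_right _ hz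
        _ = _ := by ring
    have h2 : (a / D.C * D.r + d) * D.C + a % D.C < D.r ^ D.digits i q * S * D.C := by
      calc _ < (a / D.C * D.r + d + 1) * D.C := by rw [add_mul _ 1]; omega
        _ ≤ _ := Nat.mul_le_mul_right _ h1
    have h3 : a ≤ (a / D.C * D.r + d) * D.C + a % D.C := by
      calc a = a / D.C * 1 * D.C + a % D.C := by rw [mul_one, Nat.div_add_mod']
        _ ≤ (a / D.C * D.r + d) * D.C + a % D.C := by
          gcongr
          exact (Nat.mul_le_mul_left _ D.r_pos).trans (Nat.le_add_right _ _)
    rw [e, hch.2 _ (by omega), ht _ h2, Nat.mul_add_mod_of_lt hc, mul_add_div_of_lt hc]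

/-- The cell read for cell `a` has an address of at most `a`, so a descending sweep can work in
place. -/
theorem does_expand (F : Fits p D lam S V W) (hX : width V ^ 2 ≤ X) (hi : i < D.n)
    (hq : q < D.n * D.n) (hb : Bounded V σ) (he : Env p D lam S σ)
    (h15 : σ 15 0 = ((D.r ^ D.digits i (q + 1) : ℕ) : ℤ))
    (h16 : σ 16 0 = ((D.r ^ D.crossBelow (i + 1) q : ℕ) : ℤ))
    (hd : D.digits i (q + 1) = D.digits i q + 1)
    (ht : ∀ a < D.r ^ D.digits i q * S * D.C,
      (σ 11 a : ZMod m) = D.colorTable i q (a % D.C) (a / D.C))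
    (hstep : ∀ c z, D.colorTable i (q + 1) c z =
      D.L c (z / D.r ^ D.crossBelow (i + 1) q % D.r) *
      D.colorTable i q c (z / (D.r ^ D.crossBelow (i + 1) q * D.r) * D.r ^ D.crossBelow (i + 1) q +
        z % D.r ^ D.crossBelow (i + 1) q)) :
    Does (X * (W + 1)) σ p.expand fun τ => Bounded V τ ∧
      (∀ k, k ≠ 12 → k ≠ 11 → τ k = σ k) ∧
      ∀ a < D.r ^ D.digits i (q + 1) * S * D.C,
        (τ 11 a : ZMod m) = D.colorTable i (q + 1) (a % D.C) (a / D.C) := by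
  have hcW := F.cells_le i hi (q + 1) hq
  refine does_sweepDown (m := m) (fun a => D.colorTable i (q + 1) (a % D.C) (a / D.C)) hb hX
    (by decide) (hcW.trans F.W_le) hcW ?_ ?_ fun τ hτ hch hF => ⟨hτ, hch.1, hF⟩
  · simp only [Params.cells, Term.eval_mul, eval_var, Term.eval_const, F.C_eq]
    rw [h15, he.S]
    push_cast
    rfl
  · intro a ha τ hτ hch hτa
    have henv := he.congr (τ := τ) fun k hk => hch.1 k (by omega) (by omega)
    have h16' := h16
    rw [← hch.1 16 (by decide) (by decide)] at h16'
    have hB : 0 < D.r ^ D.crossBelow (i + 1) q := pow_pos D.r_pos _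
    have hBd : D.crossBelow (i + 1) q ≤ D.digits i q := Nat.le_add_right _ _
    -- The place value `B` of the new digit divides the old number of cells, so deleting this digit
    -- from an address of the new table gives an address of the old one.
    obtain ⟨Y, hY⟩ := (pow_dvd_pow D.r hBd).mul_right S
    generalize D.r ^ D.crossBelow (i + 1) q = B at *
    have hc : a % D.C < D.C := Nat.mod_lt _ F.C_pos
    have hz : a / D.C < D.r ^ D.digits i (q + 1) * S := Nat.div_lt_of_lt_mul (by rwa [mul_comm])
    have hx : (var 12 % Term.const (p.C : ℤ)).eval τ = ((a % D.C : ℕ) : ℤ) := by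
      simp [hτa, F.C_eq]
    have hy : (var 12 / Term.const (p.C : ℤ) / var 16 % Term.const (p.r : ℤ)).eval τ =
        ((a / D.C / B % D.r : ℕ) : ℤ) := by
      simp [hτa, F.C_eq, F.r_eq, h16']
    have hd' : a / D.C / B % D.r < D.r := Nat.mod_lt _ D.r_pos
    rw [Term.eval_mod, eval_var, henv.mod]
    refine ⟨natAbs_emod_le F.m_pos F.m_le _, ?_⟩
    rw [ZMod.intCast_mod, hstep]
    have hlow : (var 12 / Term.const (p.C : ℤ) % var 16).eval τ = ((a / D.C % B : ℕ) : ℤ) := by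
      simp [hτa, F.C_eq, h16']
    have hmat := Term.eval_matrix p.L hx hy (hc.trans_eq F.C_eq.symm) (hd'.trans_eq F.r_eq.symm)
    rw [F.C_eq] at hx hlow hmat
    rw [F.r_eq] at hmat
    simp only [Term.eval_mul, Term.eval_load, Term.eval_add, eval_var,
      Term.eval_div, Term.eval_const, hmat, hlow, hx, hτa, F.C_eq, F.r_eq, h16', henv.lam]
    rw [Int.cast_mul, F.L_eq _ hc _ hd', mul_comm]
    refine congrArg (_ * ·) ?_
    set z := a / D.C with hzdef
    have e : ((a : ℤ) / D.C / (B * D.r) * B + ((z % B : ℕ) : ℤ)) * D.C + ((a % D.C : ℕ) : ℤ) =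
        (((z / (B * D.r) * B + z % B) * D.C + a % D.C : ℕ) : ℤ) := by
      rw [hzdef]; push_cast; rfl
    have h1 : z / (B * D.r) * B + z % B < D.r ^ D.digits i q * S := by
      have h4 : z / (B * D.r) < Y := by
        refine Nat.div_lt_of_lt_mul (hz.trans_eq ?_)
        rw [hd, pow_succ, mul_right_comm, hY]
        ring
      have h5 := Nat.mod_lt z hB
      calc _ < (z / (B * D.r) + 1) * B := by rw [add_mul]; omega
        _ ≤ Y * B := Nat.mul_le_mul_right _ h4
        _ = _ := by rw [hY, mul_comm]
    have h2 : (z / (B * D.r) * B + z % B) * D.C + a % D.C < D.r ^ D.digits i q * S * D.C := by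
      calc _ < (z / (B * D.r) * B + z % B + 1) * D.C := by rw [add_mul _ 1]; omega
        _ ≤ _ := Nat.mul_le_mul_right _ h1
    have h3 : (z / (B * D.r) * B + z % B) * D.C + a % D.C ≤ a := by
      have h4 : z / (B * D.r) ≤ z / B := Nat.div_le_div_left (Nat.le_mul_of_pos_right _ D.r_pos) hB
      calc _ ≤ (z / B * B + z % B) * D.C + a % D.C := by gcongr
        _ = a := by rw [Nat.div_add_mod', hzdef, Nat.div_add_mod']
    rw [e, hch.2 _ (by omega), ht _ h2, Nat.mul_add_mod_of_lt hc, mul_add_div_of_lt hc]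

end Verification

section Verification

variable {m : ℕ} {p : Params} {D : Network (ZMod m)} {lam : ℤ} {S V W X i q : ℕ} {σ : Memory}

theorem Fits.pow_digits_le (F : Fits p D lam S V W) (hi : i < D.n) (hq : q ≤ D.n * D.n) :
    D.r ^ D.digits i q ≤ V := by
  refine le_trans ?_ ((F.cells_le i hi q hq).trans F.W_le)
  rw [mul_assoc]
  exact Nat.le_mul_of_pos_right _ (Nat.mul_pos F.S_pos F.C_pos)

theorem Fits.pow_crossBelow_le (F : Fits p D lam S V W) (hi : i < D.n) (hq : q ≤ D.n * D.n) :
    D.r ^ D.crossBelow (i + 1) q ≤ V :=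
  (Nat.pow_le_pow_right D.r_pos (Nat.le_add_right _ _)).trans (F.pow_digits_le hi hq)

/-- Treating a pair that changes neither the table nor the number of digits. -/
theorem PairInv.of_item_eq (hq : q < D.n * D.n)
    (h : PairInv p D lam S V i q σ) (hit : ∀ col, D.item (i + 1) col q = D.item i col q)
    (hc : ¬ D.Cross (i + 1) q) : PairInv p D lam S V i (q + 1) σ := by
  refine ⟨h.bounded, h.env, h.pos, ?_, ?_, h.neg, ?_⟩
  · rw [D.digits_of_item_eq hq hit, h.count]
  · rw [D.crossBelow_succ, if_neg hc, h.place, add_zero]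
  · intro a ha
    rw [D.digits_of_item_eq hq hit] at ha
    rw [D.colorTable_succ_of_item_eq hq hit, h.table a ha]

theorem PairInv.pairStep (F : Fits p D lam S V W) (hX : width V ^ 2 ≤ X) (hi : i < D.n)
    (hq : q < D.n * D.n) (h : PairInv p D lam S V i q σ) (h14 : σ 14 0 = q) :
    Does (X * (W + 1)) σ p.pairStep fun τ => PairInv p D lam S V i (q + 1) τ ∧ τ 14 0 = q := by
  have hX1 : width V ^ 2 ≤ X * (W + 1) := hX.trans (Nat.le_mul_of_pos_right _ (by omega))
  have hn : 0 < D.n := by omega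
  have hu : q % D.n < D.n := Nat.mod_lt _ hn
  have hw : q / D.n < D.n := Nat.div_lt_of_lt_mul hq
  have hleft : Params.left.eval σ = ((q % D.n : ℕ) : ℤ) := by
    simp [Params.left, h14, h.env.n]
  have hright : Params.right.eval σ = ((q / D.n : ℕ) : ℤ) := by
    simp [Params.right, h14, h.env.n]
  have hadj : (Params.adj Params.left Params.right).eval σ =
      σ 3 (σ 1 ((q % D.n : ℕ) : ℤ) * σ 0 0 + σ 1 ((q / D.n : ℕ) : ℤ)) := by
    rw [Params.adj, Term.eval_load, Term.eval_add, Term.eval_mul, Term.eval_load, Term.eval_load,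
      hleft, hright, eval_var]
  refine Does.cond h.bounded hX1 (fun hb => ?_) (fun hb => ?_)
  · have hE : D.E (q % D.n) (q / D.n) := by
      by_contra hE
      exact hb (by rw [Term.eval_mul, hadj, h.env.adj_zero _ hu _ hw hE, zero_mul])
    have huw : q % D.n < q / D.n := by
      by_contra huw
      apply hb
      rw [Term.eval_mul, Term.eval_lt, hleft, hright, if_neg (by exact_mod_cast huw), mul_zero]
    refine Does.cond h.bounded hX1 (fun hb2 => ?_) (fun hb2 => ?_)
    -- The right end is the current vertex.
    · have hwi : q / D.n = i := by
        by_contra hwi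
        apply hb2
        rw [Term.eval_eq, hright, eval_var, h.pos, if_neg (by exact_mod_cast hwi)]
      have hd := D.digits_right hq hE (by omega) hwi
      have hcr : D.crossBelow (i + 1) (q + 1) = D.crossBelow (i + 1) q := by
        rw [D.crossBelow_succ, if_neg (fun hc => by have := hc.2.2; omega), add_zero]
      have hval : (var 15 / Term.const (p.r : ℤ)).eval σ =
          ((D.r ^ D.digits i (q + 1) : ℕ) : ℤ) := by
        rw [Term.eval_div, eval_var, h.count, Term.eval_const, F.r_eq, ← hd, pow_succ]
        norm_cast
        exact Nat.mul_div_cancel _ D.r_pos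
      refine Does.seq (Does.store h.bounded hX1 ?_)
      rw [hval, Term.eval_const]
      refine (does_contract F hX hi hq (h.bounded.write _ _ ?_) (h.env.congr ?_) ?_ hd ?_
        (D.colorTable_succ_right hq hE (by omega) hwi (D.crossBelow_eq_zero ?_))).mono le_rfl ?_
      · simpa using F.pow_digits_le hi hq
      · intro k hk
        funext z
        rw [write_apply, if_neg (by omega)]
      · simp [write_apply]
      · intro a ha
        rw [write_apply, if_neg (by omega)]
        exact h.table a ha
      · rw [← hwi, add_mul, one_mul, mul_comm]
        have := Nat.div_add_mod q D.n
        omega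
      · rintro τ ⟨h1, h2, h3⟩
        have h2' : ∀ k, k ≠ 12 → k ≠ 11 → k ≠ 15 → τ k = σ k := by
          intro k hk hk' hk''
          rw [h2 k hk hk']
          funext z
          rw [write_apply, if_neg (by omega)]
        refine ⟨⟨h1, h.env.congr fun k hk => h2' k (by omega) (by omega) (by omega), ?_, ?_, ?_, ?_,
          h3⟩, ?_⟩
        · rw [h2' 13 (by decide) (by decide) (by decide), h.pos]
        · rw [h2 15 (by decide) (by decide)]
          simp [write_apply]
        · rw [h2' 16 (by decide) (by decide) (by decide), h.place, hcr]
        · rw [h2' 10 (by decide) (by decide) (by decide)]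
          exact h.neg
        · rw [h2' 14 (by decide) (by decide) (by decide), h14]
    · have hwi : q / D.n ≠ i := by
        intro hwi
        rw [Term.eval_eq, hright, eval_var, h.pos, if_pos (by exact_mod_cast hwi)] at hb2
        exact one_ne_zero hb2
      refine Does.cond h.bounded hX1 (fun hb3 => ?_) (fun hb3 => ?_)
      -- The left end is the current vertex.
      · have hui : q % D.n = i := by
          by_contra hui
          apply hb3
          rw [Term.eval_eq, hleft, eval_var, h.pos, if_neg (by exact_mod_cast hui)]
        have hd := D.digits_left hq hE hui (by omega)
        have hcr : D.crossBelow (i + 1) (q + 1) = D.crossBelow (i + 1) q + 1 := by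
          rw [D.crossBelow_succ, if_pos ⟨hE, by omega, by omega⟩]
        have hval : (var 15 * Term.const (p.r : ℤ)).eval σ =
            ((D.r ^ D.digits i (q + 1) : ℕ) : ℤ) := by
          rw [Term.eval_mul, eval_var, h.count, Term.eval_const, F.r_eq, hd, pow_succ]
          push_cast
          rfl
        refine Does.seq (Does.store h.bounded hX1 ?_)
        rw [hval, Term.eval_const]
        refine Does.seq ((does_expand F hX hi hq (h.bounded.write _ _ ?_) (h.env.congr ?_) ?_ ?_ hd
          ?_ (D.colorTable_succ_left hq hE hui (by omega))).mono le_rfl ?_)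
        · simpa using F.pow_digits_le hi hq
        · intro k hk
          funext z
          rw [write_apply, if_neg (by omega)]
        · simp [write_apply]
        · rw [write_apply, if_neg (by omega), h.place]
        · intro a ha
          rw [write_apply, if_neg (by omega)]
          exact h.table a ha
        · rintro τ ⟨h1, h2, h3⟩
          have h2' : ∀ k, k ≠ 12 → k ≠ 11 → k ≠ 15 → τ k = σ k := by
            intro k hk hk' hk''
            rw [h2 k hk hk']
            funext z
            rw [write_apply, if_neg (by omega)]
          have hval2 : (var 16 * Term.const (p.r : ℤ)).eval τ =
              ((D.r ^ D.crossBelow (i + 1) (q + 1) : ℕ) : ℤ) := by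
            rw [Term.eval_mul, eval_var, h2' 16 (by decide) (by decide) (by decide), h.place,
              Term.eval_const, F.r_eq, hcr, pow_succ]
            push_cast
            rfl
          refine Does.store h1 hX1 ?_
          rw [hval2, Term.eval_const]
          have hwr : ∀ k, k ≠ 16 → ∀ z, τ.write 16 0 ((D.r ^ D.crossBelow (i + 1) (q + 1) : ℕ) : ℤ)
              k z = τ k z := by
            intro k hk z
            rw [write_apply, if_neg (by omega)]
          refine ⟨⟨h1.write _ _ ?_, h.env.congr fun k hk => ?_, ?_, ?_, ?_, ?_, ?_⟩, ?_⟩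
          · simpa using F.pow_crossBelow_le hi hq
          · rw [← h2' k (by omega) (by omega) (by omega)]
            exact funext (hwr k (by omega))
          · rw [hwr 13 (by decide), h2' 13 (by decide) (by decide) (by decide), h.pos]
          · rw [hwr 15 (by decide), h2 15 (by decide) (by decide)]
            simp [write_apply]
          · simp [write_apply]
          · intro z hz
            rw [hwr 10 (by decide), h2' 10 (by decide) (by decide) (by decide)]
            exact h.neg z hz
          · intro a ha
            rw [hwr 11 (by decide)]
            exact h3 a ha
          · rw [hwr 14 (by decide), h2' 14 (by decide) (by decide) (by decide), h14]
      · have hui : q % D.n ≠ i := by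
          intro hui
          rw [Term.eval_eq, hleft, eval_var, h.pos, if_pos (by exact_mod_cast hui)] at hb3
          exact one_ne_zero hb3
        have hit : ∀ col, D.item (i + 1) col q = D.item i col q := by
          intro col
          have e1 : q % D.n < i + 1 ↔ q % D.n < i := by omega
          have e2 : q / D.n < i + 1 ↔ q / D.n < i := by omega
          unfold Network.item
          split_ifs <;> first | rfl | tauto
        have hcond : (Params.left.lt (var 13) * (var 13).lt Params.right).eval σ =
            if q % D.n < i ∧ i < q / D.n then 1 else 0 := by
          rw [Term.eval_mul, Term.eval_lt, Term.eval_lt, hleft, hright, eval_var, h.pos]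
          norm_cast
          split_ifs <;> simp_all
        refine Does.cond h.bounded hX1 (fun hb4 => ?_) (fun hb4 => ?_)
        -- The edge passes over the current vertex, and only the place value changes.
        · rw [hcond] at hb4
          have hb5 : q % D.n < i ∧ i < q / D.n := by
            by_contra hb5
            exact hb4 (if_neg hb5)
          have hcr : D.crossBelow (i + 1) (q + 1) = D.crossBelow (i + 1) q + 1 := by
            rw [D.crossBelow_succ, if_pos ⟨hE, by omega, by omega⟩]
          have hval2 : (var 16 * Term.const (p.r : ℤ)).eval σ =
              ((D.r ^ D.crossBelow (i + 1) (q + 1) : ℕ) : ℤ) := by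
            rw [Term.eval_mul, eval_var, h.place, Term.eval_const, F.r_eq, hcr, pow_succ]
            push_cast
            rfl
          refine Does.store h.bounded hX1 ?_
          rw [hval2, Term.eval_const]
          have hwr : ∀ k, k ≠ 16 → ∀ z, σ.write 16 0 ((D.r ^ D.crossBelow (i + 1) (q + 1) : ℕ) : ℤ)
              k z = σ k z := by
            intro k hk z
            rw [write_apply, if_neg (by omega)]
          refine ⟨⟨h.bounded.write _ _ ?_, h.env.congr fun k hk => funext (hwr k (by omega)), ?_,
            ?_, ?_, ?_, ?_⟩, ?_⟩
          · simpa using F.pow_crossBelow_le hi hq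
          · rw [hwr 13 (by decide), h.pos]
          · rw [hwr 15 (by decide), h.count, D.digits_of_item_eq hq hit]
          · simp [write_apply]
          · intro z hz
            rw [hwr 10 (by decide)]
            exact h.neg z hz
          · intro a ha
            rw [D.digits_of_item_eq hq hit] at ha
            rw [hwr 11 (by decide), D.colorTable_succ_of_item_eq hq hit]
            exact h.table a ha
          · rw [hwr 14 (by decide), h14]
        · rw [hcond] at hb4
          have hb5 : ¬ (q % D.n < i ∧ i < q / D.n) := by
            intro hb5
            rw [if_pos hb5] at hb4
            exact one_ne_zero hb4
          exact Does.nop hX1 ⟨h.of_item_eq hq hit fun hc => by have := hc.2; omega, h14⟩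
  · have hE : ¬ (D.E (q % D.n) (q / D.n) ∧ q % D.n < q / D.n) := by
      rintro ⟨hE, huw⟩
      rw [Term.eval_mul, Term.eval_lt, hadj, h.env.adj_one _ hu _ hw hE, hleft, hright,
        if_pos (by exact_mod_cast huw)] at hb
      exact absurd hb (by decide)
    refine Does.nop hX1 ⟨h.of_item_eq hq ?_ ?_, h14⟩
    · intro col
      rw [Network.item, if_neg (fun hc => hE ⟨hc.1, hc.2.1⟩), Network.item,
        if_neg (fun hc => hE ⟨hc.1, hc.2.1⟩)]
    · exact fun hc => hE ⟨hc.1, hc.2.1.trans_le hc.2.2⟩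

theorem PairInv.pairLoop (F : Fits p D lam S V W) (hX : width V ^ 2 ≤ X) (hi : i < D.n)
    (h : PairInv p D lam S V i 0 σ) (h14 : σ 14 0 = 0) :
    Does (X * (W + 1) * (D.n * D.n + 1)) σ p.pairLoop
      (PairInv p D lam S V i (D.n * D.n)) := by
  have hX1 : width V ^ 2 ≤ X * (W + 1) := hX.trans (Nat.le_mul_of_pos_right _ (by omega))
  refine (Does.loop (fun q σ => PairInv p D lam S V i q σ ∧ σ 14 0 = q) (D.n * D.n) hX1
    (fun _ _ hσ => hσ.1.bounded) ?_ ?_ ⟨h, h14⟩).mono le_rfl fun _ hτ => hτ.1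
  · rintro q hq σ ⟨h, h14⟩
    refine ⟨?_, Does.seq ((h.pairStep F hX hi hq h14).mono le_rfl ?_)⟩
    · rw [Term.eval_lt, Term.eval_mul, eval_var, eval_var, h14, h.env.n,
        if_pos (by exact_mod_cast hq)]
      exact one_ne_zero
    · rintro τ ⟨h1, h2⟩
      have hval : (var 14 + Term.const 1).eval τ = ((q + 1 : ℕ) : ℤ) := by simp [h2]
      refine Does.store h1.bounded hX1 ?_
      rw [hval, Term.eval_const]
      have hwr : ∀ k, k ≠ 14 → ∀ z, τ.write 14 0 ((q + 1 : ℕ) : ℤ) k z = τ k z := by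
        intro k hk z
        rw [write_apply, if_neg (by omega)]
      refine ⟨⟨h1.bounded.write _ _ ?_, h1.env.congr fun k hk => funext (hwr k (by omega)), ?_, ?_,
        ?_, ?_, ?_⟩, ?_⟩
      · have := F.n_le
        omega
      · rw [hwr 13 (by decide), h1.pos]
      · rw [hwr 15 (by decide), h1.count]
      · rw [hwr 16 (by decide), h1.place]
      · intro z hz
        rw [hwr 10 (by decide), h1.neg z hz]
      · intro a ha
        rw [hwr 11 (by decide), h1.table a ha]
      · simp [write_apply]
  · rintro τ ⟨h1, h2⟩
    rw [Term.eval_lt, Term.eval_mul, eval_var, eval_var, h2, h1.env.n, if_neg]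
    push_cast
    exact lt_irrefl _

theorem PairInv.collect (F : Fits p D lam S V W) (hX : width V ^ 2 ≤ X) (hi : i < D.n)
    (h : PairInv p D lam S V i (D.n * D.n) σ) :
    Does (X * (W + 1)) σ p.collect fun τ => Bounded V τ ∧
      Changes 12 10 (fun z => 0 ≤ z ∧ z < (D.r ^ D.digits (i + 1) 0 * S : ℕ)) σ τ ∧
      ∀ z < D.r ^ D.digits (i + 1) 0 * S, (τ 10 z : ZMod m) = D.table (i + 1) z := by
  have hcW : D.r ^ D.digits i (D.n * D.n) * S ≤ W :=
    (Nat.le_mul_of_pos_right _ F.C_pos).trans (F.cells_le i hi _ le_rfl)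
  rw [← D.digits_last]
  refine does_sweepUp (m := m) (fun z => D.table (i + 1) z) h.bounded hX
    (by decide) (hcW.trans F.W_le) hcW ?_ ?_ fun τ h1 h2 h3 => ⟨h1, h2, h3⟩
  · intro τ hτ
    simp only [Term.eval_mul, eval_var]
    rw [hτ 15 (by decide) (by decide), hτ 7 (by decide) (by decide), h.count, h.env.S]
    push_cast
    rfl
  · intro a ha τ hτ hch hτa
    have henv := h.env.congr (τ := τ) fun k hk => hch.1 k (by omega) (by omega)
    rw [Term.eval_mod, eval_var, henv.mod]
    refine ⟨natAbs_emod_le F.m_pos F.m_le _, ?_⟩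
    rw [ZMod.intCast_mod, D.table_succ, Term.eval_sum_range, Int.cast_sum, F.C_eq]
    refine Finset.sum_congr rfl fun c hc => ?_
    have hc := Finset.mem_range.1 hc
    have hlt : a * D.C + c < D.r ^ D.digits i (D.n * D.n) * S * D.C := by
      calc _ < (a + 1) * D.C := by rw [add_mul]; omega
        _ ≤ _ := Nat.mul_le_mul_right _ ha
    have e : (var 12 * Term.const (D.C : ℤ) + Term.const (c : ℤ)).eval τ =
        ((a * D.C + c : ℕ) : ℤ) := by
      simp [hτa]
    rw [Term.eval_load, e, hch.1 11 (by decide) (by decide), h.table _ hlt,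
      Nat.mul_add_mod_of_lt hc, mul_add_div_of_lt hc]

theorem VertexInv.vertexStep (F : Fits p D lam S V W) (hX : width V ^ 2 ≤ X) (hi : i < D.n)
    (h : VertexInv p D lam S V i σ) :
    Does (X * (W + 1) * (D.n * D.n + 1)) σ p.vertexStep (VertexInv p D lam S V (i + 1)) := by
  have hX2 : X * (W + 1) ≤ X * (W + 1) * (D.n * D.n + 1) :=
    Nat.le_mul_of_pos_right _ (Nat.succ_pos _)
  have hX1 : width V ^ 2 ≤ X * (W + 1) * (D.n * D.n + 1) :=
    hX.trans ((Nat.le_mul_of_pos_right _ (Nat.succ_pos _)).trans hX2)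
  have hV : 1 ≤ V := F.m_pos.trans_le F.m_le
  refine Does.seq ((h.introduce F hX hi).mono hX2 ?_)
  rintro τ ⟨h1, h2, h3, h4, h5, h6⟩
  have h1' : Bounded V (τ.write 16 0 1) := h1.write _ _ (by simpa using hV)
  refine Does.seq (Does.store h1 hX1 (Does.seq (Does.store h1' hX1 (Does.seq ?_))))
  simp only [Term.eval_const]
  have hwr : ∀ k, k ≠ 14 → k ≠ 16 → ∀ z, ((τ.write 16 0 1).write 14 0 0) k z = τ k z := by
    intro k hk hk' z
    rw [write_apply, if_neg (by omega), write_apply, if_neg (by omega)]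
  refine (PairInv.pairLoop F hX hi ⟨h1'.write _ _ (by simp),
    h2.congr fun k hk => funext (hwr k (by omega) (by omega)), ?_, ?_, ?_, ?_, ?_⟩ ?_).mono
    le_rfl ?_
  · rw [hwr 13 (by decide) (by decide), h3]
  · rw [hwr 15 (by decide) (by decide), h4]
  · simp [write_apply, D.crossBelow_eq_zero]
  · intro z hz
    rw [hwr 10 (by decide) (by decide), h5 z hz]
  · intro a ha
    rw [hwr 11 (by decide) (by decide), h6 a ha]
  · simp [write_apply]
  · intro υ hυ
    refine Does.seq ((hυ.collect F hX hi).mono hX2 ?_)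
    rintro ρ ⟨h7, h8, h9⟩
    have hval : (var 13 + Term.const 1).eval ρ = ((i + 1 : ℕ) : ℤ) := by
      simp [h8.1 13 (by decide) (by decide), hυ.pos]
    refine Does.store h7 hX1 ?_
    rw [hval, Term.eval_const]
    have hwr : ∀ k, k ≠ 13 → ∀ z, ρ.write 13 0 ((i + 1 : ℕ) : ℤ) k z = ρ k z := by
      intro k hk z
      rw [write_apply, if_neg (by omega)]
    refine ⟨h7.write _ _ ?_, hυ.env.congr fun k hk => ?_, ?_, ?_, ?_, ?_⟩
    · have := F.n_le
      have := Nat.le_mul_self D.n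
      omega
    · rw [← h8.1 k (by omega) (by omega)]
      exact funext (hwr k (by omega))
    · simp [write_apply]
    · rw [hwr 15 (by decide), h8.1 15 (by decide) (by decide), hυ.count, D.digits_last]
    · intro z hz
      rw [hwr 10 (by decide), h8.2 z (by omega), hυ.neg z hz]
    · intro z hz
      rw [hwr 10 (by decide), h9 z hz]

theorem VertexInv.vertexLoop (F : Fits p D lam S V W) (hX : width V ^ 2 ≤ X)
    (h : VertexInv p D lam S V 0 σ) :
    Does (X * (W + 1) * (D.n * D.n + 1) * (D.n + 1)) σ p.vertexLoop
      (VertexInv p D lam S V D.n) := by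
  have hX1 : width V ^ 2 ≤ X * (W + 1) * (D.n * D.n + 1) :=
    hX.trans ((Nat.le_mul_of_pos_right _ (Nat.succ_pos _)).trans
      (Nat.le_mul_of_pos_right _ (Nat.succ_pos _)))
  refine Does.loop _ D.n hX1 (fun _ _ hσ => hσ.bounded) ?_ ?_ h
  · intro i hi σ h
    refine ⟨?_, h.vertexStep F hX hi⟩
    rw [Term.eval_lt, eval_var, eval_var, h.pos, h.env.n, if_pos (by exact_mod_cast hi)]
    exact one_ne_zero
  · intro τ h
    rw [Term.eval_lt, eval_var, eval_var, h.pos, h.env.n, if_neg (lt_irrefl _)]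

end Verification

/-! ### Initialization and output -/

namespace Params

variable (p : Params)

/-- Multiply variable `17` by the number of colors, once for every vertex. -/
def powerLoop : Prog :=
  .loop ((var 13).lt (var 0)) (.seq (.store 17 (.const 0) (var 17 * .const p.C))
    (.store 13 (.const 0) (var 13 + .const 1)))

/-- Compute the constants and the table for the empty set of vertices. -/
def setup : Prog :=
  .seq (.store 8 (.const 0) (var 0 * .load 0 (.const 1) + .const 1))
    (.seq (.store 7 (.const 0) ((var 0 + .const 1) * var 8))
    (.seq (.store 17 (.const 0) (.const 1))
    (.seq p.powerLoop
    (.seq (.store 5 (.const 0) (.const p.modCoeff.1 * var 17 + .const p.modCoeff.2))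
    (.seq (.store 6 (.const 0) (.const p.scaleCoeff.1 * var 17 + .const p.scaleCoeff.2))
    (.seq (.store 10 (.const 0) (.const 1))
    (.seq (.store 15 (.const 0) (.const 1))
    (.store 13 (.const 0) (.const 0)))))))))

/-- Read off the result. Numbers of special vertices above `n` and weights above `n * N` are not
represented in the table; the answer is `0` for them. -/
def output : Prog :=
  .store 0 (.const 0) (.load 10 (.load 0 (.const 2) * var 8 + .load 0 (.const 3)) % var 5 *
    Term.lt (.load 0 (.const 2)) (var 0 + .const 1) * Term.lt (.load 0 (.const 3)) (var 8))

/-- The whole program. -/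
def program : Prog := .seq p.setup (.seq p.vertexLoop output)

/-- The state after initialization. -/
structure Ready (n N V : ℕ) (σ τ : Memory) : Prop where
  bounded : Bounded V τ
  input : ∀ k < 5, τ k = σ k
  mod : τ 5 0 = p.modCoeff.1 * p.C ^ n + p.modCoeff.2
  scale : τ 6 0 = p.scaleCoeff.1 * p.C ^ n + p.scaleCoeff.2
  codes : τ 7 0 = ((n + 1) * (n * N + 1) : ℕ)
  mult : τ 8 0 = (n * N + 1 : ℕ)
  table : ∀ z, τ 10 z = if z = 0 then 1 else 0
  pos : τ 13 0 = 0
  count : τ 15 0 = 1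

variable {p} {n N V X : ℕ} {σ : Memory}

theorem does_powerLoop (hX : width V ^ 2 ≤ X) (hb : Bounded V σ) (hn : σ 0 0 = n)
    (h13 : σ 13 0 = 0) (h17 : σ 17 0 = 1) (hC : 0 < p.C) (hpow : p.C ^ n ≤ V) (hnV : n ≤ V) :
    Does (X * (n + 1)) σ p.powerLoop fun τ => Bounded V τ ∧
      (∀ k, k ≠ 13 → k ≠ 17 → τ k = σ k) ∧ τ 17 0 = p.C ^ n := by
  refine (Does.loop (fun i τ => Bounded V τ ∧ (∀ k, k ≠ 13 → k ≠ 17 → τ k = σ k) ∧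
    τ 13 0 = i ∧ τ 17 0 = ((p.C ^ i : ℕ) : ℤ)) n hX (fun _ _ h => h.1) ?_ ?_
    ⟨hb, fun _ _ _ => rfl, by simpa using h13, by simpa using h17⟩).mono le_rfl ?_
  · rintro i hi τ ⟨h1, h2, h3, h4⟩
    have h0 : τ 0 0 = n := by rw [h2 0 (by decide) (by decide), hn]
    refine ⟨by simp [h0, h3, hi], Does.seq (Does.store h1 hX ?_)⟩
    have hval : (var 17 * Term.const (p.C : ℤ)).eval τ = ((p.C ^ (i + 1) : ℕ) : ℤ) := by
      simp [h4, pow_succ]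
    rw [hval, Term.eval_const]
    have hle : p.C ^ (i + 1) ≤ V := (Nat.pow_le_pow_right hC hi).trans hpow
    have h5 : Bounded V (τ.write 17 0 ((p.C ^ (i + 1) : ℕ) : ℤ)) := h1.write _ _ (by omega)
    refine Does.store h5 hX ?_
    have hval2 : (var 13 + Term.const 1).eval (τ.write 17 0 ((p.C ^ (i + 1) : ℕ) : ℤ)) =
        ((i + 1 : ℕ) : ℤ) := by
      simp [write_apply, h3]
    rw [hval2, Term.eval_const]
    refine ⟨h5.write _ _ (by omega), ?_, by simp [write_apply], by simp [write_apply]⟩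
    intro k hk hk'
    rw [← h2 k hk hk']
    funext z
    simp [write_apply, hk, hk']
  · rintro τ ⟨h1, h2, h3, h4⟩
    simp [h2 0 (by decide) (by decide), hn, h3]
  · rintro τ ⟨h1, h2, h3, h4⟩
    exact ⟨h1, h2, by rw [h4]; push_cast; rfl⟩

theorem does_setup (hX : width V ^ 2 ≤ X) (hb : Bounded V σ) (hn : σ 0 0 = n) (hN : σ 0 1 = N)
    (hzero : ∀ k, 5 ≤ k → ∀ z, σ k z = 0) (hC : 0 < p.C) (hpow : p.C ^ n ≤ V) (hnV : n ≤ V)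
    (hK : n * N + 1 ≤ V) (hS : (n + 1) * (n * N + 1) ≤ V)
    (hmod : (p.modCoeff.1 * p.C ^ n + p.modCoeff.2).natAbs ≤ V)
    (hscale : (p.scaleCoeff.1 * p.C ^ n + p.scaleCoeff.2).natAbs ≤ V) :
    Does (X * (n + 1)) σ p.setup (p.Ready n N V σ) := by
  have hX1 : width V ^ 2 ≤ X * (n + 1) := hX.trans (Nat.le_mul_of_pos_right _ (Nat.succ_pos _))
  have hV : 1 ≤ V := by omega
  refine Does.seq (Does.store hb hX1 ?_)
  have hval : (var 0 * Term.load 0 (.const 1) + Term.const 1).eval σ = ((n * N + 1 : ℕ) : ℤ) := by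
    simp [hn, hN]
  rw [hval, Term.eval_const]
  have hb1 : Bounded V (σ.write 8 0 ((n * N + 1 : ℕ) : ℤ)) := hb.write _ _ (by omega)
  refine Does.seq (Does.store hb1 hX1 ?_)
  have hval2 : ((var 0 + Term.const 1) * var 8).eval (σ.write 8 0 ((n * N + 1 : ℕ) : ℤ)) =
      (((n + 1) * (n * N + 1) : ℕ) : ℤ) := by
    simp [write_apply, hn]
  rw [hval2, Term.eval_const]
  have hb2 := hb1.write 7 0 (z := (((n + 1) * (n * N + 1) : ℕ) : ℤ))
    (by rw [Int.natAbs_natCast]; exact hS)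
  refine Does.seq (Does.store hb2 hX1 ?_)
  simp only [Term.eval_const]
  have hb3 := hb2.write 17 0 (z := 1) (by simpa using hV)
  refine Does.seq ((does_powerLoop hX hb3 (n := n) ?_ ?_ ?_ hC hpow hnV).mono le_rfl ?_)
  · simp [write_apply, hn]
  · simp [write_apply, hzero]
  · simp [write_apply]
  rintro τ ⟨h1, h2, h3⟩
  refine Does.seq (Does.store h1 hX1 ?_)
  simp only [Term.eval_const, Term.eval_add, Term.eval_mul, eval_var, h3]
  have hb4 := h1.write 5 0 hmod
  refine Does.seq (Does.store hb4 hX1 ?_)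
  simp only [Term.eval_const, Term.eval_add, Term.eval_mul, eval_var, write_apply _ 5 17,
    show (17 = 5) = False by decide, false_and, if_false, h3]
  have hb5 := hb4.write 6 0 hscale
  refine Does.seq (Does.store hb5 hX1 ?_)
  simp only [Term.eval_const]
  have hb6 := hb5.write 10 0 (z := 1) (by simpa using hV)
  refine Does.seq (Does.store hb6 hX1 ?_)
  simp only [Term.eval_const]
  have hb7 := hb6.write 15 0 (z := 1) (by simpa using hV)
  refine Does.store hb7 hX1 ?_
  simp only [Term.eval_const]
  refine ⟨hb7.write _ _ (by simp), ?_, ?_, ?_, ?_, ?_, ?_, ?_, ?_⟩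
  · intro k hk
    funext z
    simp only [write_apply]
    rw [if_neg (by omega), if_neg (by omega), if_neg (by omega), if_neg (by omega),
      if_neg (by omega), h2 k (by omega) (by omega)]
    simp only [write_apply]
    rw [if_neg (by omega), if_neg (by omega), if_neg (by omega)]
  · simp [write_apply]
  · simp [write_apply]
  · simp [write_apply, h2 7 (by decide) (by decide)]
  · simp [write_apply, h2 8 (by decide) (by decide)]
  · intro z
    simp [write_apply, h2 10 (by decide) (by decide), hzero]
  · simp [write_apply]
  · simp [write_apply]

end Params

/-! ### The final table -/

namespace Network

variable {𝕜 : Type*} [CommRing 𝕜] (D : Network 𝕜)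

theorem crossBelow_last : D.crossBelow D.n (D.n * D.n) = 0 := D.crossBelow_eq_zero le_rfl

theorem crossBelow_none (q : ℕ) : D.crossBelow 0 q = 0 := by
  simp [crossBelow, Cross]

open Classical in
/-- When all vertices are processed, the table counts the colorings of each weight code. -/
theorem table_last (Ok : ℕ → ℕ → Prop)
    (hM : ∀ c < D.C, ∀ c' < D.C, D.M c c' = if Ok c c' then 1 else 0) (z : ℕ) :
    D.table D.n z = (Finset.univ.filter fun g : Fin D.n → Fin D.C =>
      (∀ t < D.n, D.allowed t (extend g t)) ∧
      (∀ q < D.n * D.n, D.E (q % D.n) (q / D.n) → q % D.n < q / D.n →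
        Ok (extend g (q % D.n)) (extend g (q / D.n))) ∧
      D.weight D.n (extend g) = z).card := by
  rw [table, sumCol_eq_sum, Finset.natCast_card_filter]
  refine Finset.sum_congr rfl fun g _ => ?_
  have hg : ∀ t < D.n, extend g t < D.C := fun t ht => by
    rw [extend, dif_pos ht]
    exact (g _).2
  have hl : ∀ l : List ℕ, (∀ q ∈ l, q < D.n * D.n) →
      tval D.r D.L (D.weight D.n (extend g)) (l.map (D.item D.n (extend g))) z =
        if (∀ q ∈ l, D.E (q % D.n) (q / D.n) → q % D.n < q / D.n →
          Ok (extend g (q % D.n)) (extend g (q / D.n))) ∧ D.weight D.n (extend g) = z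
        then 1 else 0 := by
    intro l hlt
    induction l with
    | nil => simp [tval]
    | cons q l ih =>
      have hq : q < D.n * D.n := hlt q (List.mem_cons_self ..)
      have hn : 0 < D.n := Nat.pos_of_ne_zero fun h => by simp [h] at hq
      have hu : q % D.n < D.n := Nat.mod_lt _ hn
      have hw : q / D.n < D.n := Nat.div_lt_of_lt_mul hq
      have ih := ih fun a ha => hlt a (List.mem_cons_of_mem _ ha)
      rw [List.map_cons, item]
      simp only [hu, hw, and_true, if_true, List.forall_mem_cons]
      split_ifs with h1 h2 h2 <;> rw [tval, ih]
      · simp [hM _ (hg _ hu) _ (hg _ hw), h2.1.1 h1.1 h1.2]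
        intro h3
        exact absurd h2.2 (h3 h2.1.2)
      · rw [hM _ (hg _ hu) _ (hg _ hw)]
        split_ifs with h3 h4
        · exact absurd ⟨⟨fun _ _ => h3, h4.1⟩, h4.2⟩ h2
        all_goals simp
      · rw [if_pos ⟨h2.1.2, h2.2⟩, one_mul]
      · rw [if_neg, mul_zero]
        exact fun h3 => h2 ⟨⟨fun h4 h5 => absurd ⟨h4, h5⟩ h1, h3.1⟩, h3.2⟩
  rw [stage, List.range_zero, List.map_nil, List.nil_append, hl]
  · rw [listFactor, Finset.prod_boole]
    simp only [List.mem_range'_1, Finset.mem_range, Nat.zero_le, true_and, Nat.sub_zero, zero_add]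
    split_ifs <;> simp_all
  · intro q hq
    have := List.mem_range'_1.1 hq
    omega

end Network

/-! ### Factoring the consistency matrix -/

/-- The columns of `L` are a basis of the column space, and `R` contains the coordinates. -/
theorem Matrix.exists_eq_mul_of_rank {K ι : Type*} [Field K] [Fintype ι] [DecidableEq ι]
    (A : Matrix ι ι K) : ∃ (L : Matrix ι (Fin A.rank) K) (R : Matrix (Fin A.rank) ι K),
      A = L * R := by
  let b := Module.finBasisOfFinrankEq K (LinearMap.range A.mulVecLin) (rfl : _ = A.rank)
  refine ⟨.of fun i d => (b d : ι → K) i,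
    .of fun d j => b.repr ⟨A.mulVecLin (Pi.single j 1), LinearMap.mem_range_self _ _⟩ d, ?_⟩
  ext i j
  have h := congrArg (fun v : LinearMap.range A.mulVecLin => (v : ι → K) i)
    (b.sum_repr ⟨A.mulVecLin (Pi.single j 1), LinearMap.mem_range_self _ _⟩)
  simp only [Submodule.coe_sum, Submodule.coe_smul, Finset.sum_apply, Pi.smul_apply,
    smul_eq_mul, Matrix.mulVecLin_apply, Matrix.mulVec_single_one] at h
  rw [Matrix.mul_apply]
  simp only [Matrix.of_apply, Matrix.mulVecLin_apply, Matrix.mulVec_single_one]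
  rw [← Matrix.col_apply A, ← h]
  exact Finset.sum_congr rfl fun d _ => mul_comm _ _

/-- Clearing denominators. -/
theorem exists_mul_eq_intCast {ι κ : Type*} [Fintype ι] [Fintype κ] (f : ι → κ → ℚ) :
    ∃ D : ℕ, 0 < D ∧ ∃ g : ι → κ → ℤ, ∀ i j, (D : ℚ) * f i j = g i j := by
  classical
  have hdvd : ∀ i j, (f i j).den ∣ ∏ x : ι × κ, (f x.1 x.2).den := fun i j =>
    Finset.dvd_prod_of_mem (fun x : ι × κ => (f x.1 x.2).den) (Finset.mem_univ (i, j))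
  refine ⟨∏ x : ι × κ, (f x.1 x.2).den, Finset.prod_pos fun x _ => (f x.1 x.2).pos,
    fun i j => ((∏ x : ι × κ, (f x.1 x.2).den) / (f i j).den : ℕ) * (f i j).num, fun i j => ?_⟩
  obtain ⟨k, hk⟩ := hdvd i j
  simp only [hk, Nat.mul_div_cancel_left _ (f i j).pos]
  push_cast
  rw [mul_comm ((f i j).den : ℚ), mul_assoc, Rat.den_mul_eq_num]

/-- The extension of a finite matrix by zeros. -/
def extendMatrix {a b : ℕ} (f : Fin a → Fin b → ℤ) (i j : ℕ) : ℤ :=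
  if h : i < a ∧ j < b then f ⟨i, h.1⟩ ⟨j, h.2⟩ else 0

theorem sum_extendMatrix {a b c : ℕ} (f : Fin a → Fin b → ℤ) (g : Fin b → Fin c → ℤ)
    (i : Fin a) (j : Fin c) : ∑ d ∈ Finset.range b, extendMatrix f i d * extendMatrix g d j =
      ∑ d : Fin b, f i d * g d j := by
  rw [← Fin.sum_univ_eq_sum_range fun d => extendMatrix f i d * extendMatrix g d j]
  simp [extendMatrix]

namespace ColoringLikeProblem

/-- Suitable parameters. Without a prime, an integer multiple `D • M` is a product `L * R` of
integer matrices. Modulo `D * C ^ n + 1`, which exceeds the number of colorings, the number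
`-C ^ n` is inverse to `D`. -/
theorem exists_params (P : ColoringLikeProblem) : ∃ p : Params, p.C = P.numColors ∧ p.r = P.rank ∧
    (∀ c : Fin P.numColors, p.special c = if c ∈ P.special then 1 else 0) ∧
    ∀ n : ℕ, ∃ m : ℕ, 0 < m ∧ (m : ℤ) = p.modCoeff.1 * p.C ^ n + p.modCoeff.2 ∧
      (∀ c c' : Fin P.numColors,
        (((p.scaleCoeff.1 * p.C ^ n + p.scaleCoeff.2) *
          ∑ d ∈ Finset.range p.r, p.L c d * p.R d c' : ℤ) : ZMod m) = (P.M c c' : ZMod m)) ∧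
      ∀ x ≤ P.numColors ^ n, x % m = match P.prime with
        | none => x
        | some p => x % p := by
  let spec : ℕ → ℤ := fun c => if h : c < P.numColors then
    if (⟨c, h⟩ : Fin P.numColors) ∈ P.special then 1 else 0 else 0
  have hspec : ∀ c : Fin P.numColors, spec c = if c ∈ P.special then 1 else 0 := by
    intro c
    simp [spec]
  have hprime := P.prime_isPrime
  unfold ColoringLikeProblem.rank
  generalize P.prime = o at hprime ⊢
  rcases o with _ | q
  · obtain ⟨L, R, hLR⟩ := Matrix.exists_eq_mul_of_rank (P.M.map fun x : ℕ => (x : ℚ))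
    obtain ⟨D₁, hD₁, L', hL'⟩ := exists_mul_eq_intCast L
    obtain ⟨D₂, hD₂, R', hR'⟩ := exists_mul_eq_intCast R
    refine ⟨⟨P.numColors, (P.M.map fun x : ℕ => (x : ℚ)).rank, spec, extendMatrix L',
      extendMatrix R', (D₁ * D₂, 1), (-1, 0)⟩,
      rfl, rfl, hspec, fun n => ⟨D₁ * D₂ * P.numColors ^ n + 1, Nat.succ_pos _, ?_, ?_, ?_⟩⟩
    · push_cast
      rfl
    · intro c c'
      have h1 : ∑ d, L' c d * R' d c' = (D₁ * D₂ : ℤ) * (P.M c c' : ℤ) := by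
        have h2 := congrFun (congrFun hLR c) c'
        rw [Matrix.map_apply, Matrix.mul_apply] at h2
        have h3 : ((∑ d, L' c d * R' d c' : ℤ) : ℚ) = ((D₁ * D₂ : ℤ) * (P.M c c' : ℤ) : ℤ) := by
          push_cast
          rw [h2, Finset.mul_sum]
          refine Finset.sum_congr rfl fun d _ => ?_
          rw [← hL', ← hR']
          ring
        exact_mod_cast h3
      simp only [sum_extendMatrix, h1]
      have h2 : ((D₁ * D₂ * P.numColors ^ n + 1 : ℕ) : ZMod (D₁ * D₂ * P.numColors ^ n + 1)) = 0 :=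
        ZMod.natCast_self _
      push_cast at h2 ⊢
      -- `h2` says that `D₁ * D₂ * C ^ n + 1` vanishes modulo itself.
      linear_combination (-(P.M c c' : ZMod (D₁ * D₂ * P.numColors ^ n + 1))) * h2
    · intro x hx
      refine Nat.mod_eq_of_lt ?_
      have := Nat.le_mul_of_pos_left (P.numColors ^ n) (Nat.mul_pos hD₁ hD₂)
      omega
  · have hq : Fact q.Prime := ⟨hprime q rfl⟩
    obtain ⟨L, R, hLR⟩ := Matrix.exists_eq_mul_of_rank (P.M.map fun x : ℕ => (x : ZMod q))
    refine ⟨⟨P.numColors, (P.M.map fun x : ℕ => (x : ZMod q)).rank, spec,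
      extendMatrix fun c d => (L c d).val, extendMatrix fun d c => (R d c).val, (0, q), (0, 1)⟩,
      rfl, rfl, hspec, fun n => ⟨q, hq.out.pos, ?_, ?_, ?_⟩⟩
    · simp
    · intro c c'
      simp only [sum_extendMatrix (fun c d => ((L c d).val : ℤ)) fun d c => ((R d c).val : ℤ)]
      have h2 := congrFun (congrFun hLR c) c'
      rw [Matrix.map_apply, Matrix.mul_apply] at h2
      rw [h2]
      simp
    · exact fun x _ => rfl

end ColoringLikeProblem

/-! ### The network of an instance -/

namespace ColoringLikeProblem

variable {P : ColoringLikeProblem}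

/-- The network of an instance, with matrix factors taken from the parameters. A special vertex
contributes `n * N + 1` plus its own weight to the weight code. -/
def Instance.network (I : P.Instance) (p : Params) (hr : 0 < p.r) (m : ℕ) (lam : ℤ) :
    Network (ZMod m) where
  n := I.n
  C := P.numColors
  r := p.r
  r_pos := hr
  E u w := ∃ (hu : u < I.n) (hw : w < I.n), I.G.Adj (I.ℓ ⟨u, hu⟩) (I.ℓ ⟨w, hw⟩)
  allowed t c := ∃ (ht : t < I.n) (hc : c < P.numColors), ⟨c, hc⟩ ∈ I.lists (I.ℓ ⟨t, ht⟩)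
  δ t c := if h : t < I.n ∧ c < P.numColors then
    if ⟨c, h.2⟩ ∈ P.special then I.n * I.N + 1 + I.ω (I.ℓ ⟨t, h.1⟩) else 0 else 0
  L c d := ((lam * p.L c d : ℤ) : ZMod m)
  R d c := (p.R d c : ZMod m)
  M c c' := ∑ d ∈ Finset.range p.r, ((lam * p.L c d : ℤ) : ZMod m) * (p.R d c' : ZMod m)
  mul_eq _ _ := rfl

section Count

variable (I : P.Instance) (p : Params) (hr : 0 < p.r) (m : ℕ) (lam : ℤ)

/-- The weight code of a coloring consists of the number and the total weight of the special
vertices. -/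
theorem Instance.weight_network (g : Fin I.n → Fin P.numColors) :
    (I.network p hr m lam).weight I.n (extend g) =
      (Finset.univ.filter fun v => g (I.ℓ.symm v) ∈ P.special).card * (I.n * I.N + 1) +
      ∑ v ∈ Finset.univ.filter (fun v => g (I.ℓ.symm v) ∈ P.special), I.ω v := by
  rw [← smul_eq_mul, ← Finset.sum_const, ← Finset.sum_add_distrib, Finset.sum_filter,
    ← I.ℓ.sum_comp, Network.weight,
    ← Fin.sum_univ_eq_sum_range fun t => (I.network p hr m lam).δ t (extend g t)]
  refine Finset.sum_congr rfl fun t _ => ?_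
  simp [Instance.network, extend]

theorem Instance.sum_le (s : Finset (Fin I.n)) : ∑ v ∈ s, I.ω v ≤ I.n * I.N := by
  calc ∑ v ∈ s, I.ω v ≤ ∑ v : Fin I.n, I.ω v :=
        Finset.sum_le_sum_of_subset (Finset.subset_univ s)
    _ ≤ ∑ _v : Fin I.n, I.N := Finset.sum_le_sum fun v _ => (Finset.mem_Icc.1 (I.ω_mem v)).2
    _ = _ := by simp

/-- Consistency of two colors given by their numbers. -/
def Consistent (P : ColoringLikeProblem) (c c' : ℕ) : Prop :=
  ∃ (hc : c < P.numColors) (hc' : c' < P.numColors), P.M ⟨c, hc⟩ ⟨c', hc'⟩ = 1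

open Classical in
theorem Instance.count_eq_card (hw : I.weight < I.n * I.N + 1) :
    I.count = (Finset.univ.filter fun g : Fin I.n → Fin P.numColors =>
      (∀ t < I.n, (I.network p hr m lam).allowed t (extend g t)) ∧
      (∀ q < I.n * I.n, (I.network p hr m lam).E (q % I.n) (q / I.n) → q % I.n < q / I.n →
        P.Consistent (extend g (q % I.n)) (extend g (q / I.n))) ∧
      (I.network p hr m lam).weight I.n (extend g) =
        I.order * (I.n * I.N + 1) + I.weight).card := by
  rw [Instance.count, ← Fintype.card_subtype, ← Nat.card_eq_fintype_card]
  refine Nat.card_congr (Equiv.subtypeEquiv (Equiv.arrowCongr I.ℓ (Equiv.refl _)) fun g => ?_).symm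
  have hcol : ∀ v, (Equiv.arrowCongr I.ℓ (Equiv.refl _)) g v = g (I.ℓ.symm v) := fun _ => rfl
  have hext : ∀ t (ht : t < I.n), extend g t = g ⟨t, ht⟩ := fun t ht => by simp [extend, ht]
  simp only [Instance.IsSolution, hcol]
  rw [I.weight_network]
  set A := (Finset.univ.filter fun v => g (I.ℓ.symm v) ∈ P.special).card
  have hB := I.sum_le (Finset.univ.filter fun v => g (I.ℓ.symm v) ∈ P.special)
  set B := ∑ v ∈ Finset.univ.filter (fun v => g (I.ℓ.symm v) ∈ P.special), I.ω v
  have h1 : A * (I.n * I.N + 1) + B = I.order * (I.n * I.N + 1) + I.weight ↔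
      A = I.order ∧ B = I.weight := by
    constructor
    -- The total weight is at most `n * N`, so it is the remainder of the code.
    · intro h
      have hdiv := congrArg (· / (I.n * I.N + 1)) h
      simp only [mul_add_div_of_lt (Nat.lt_succ_of_le hB), mul_add_div_of_lt hw] at hdiv
      exact ⟨hdiv, by rw [hdiv] at h; omega⟩
    · rintro ⟨hA, hB'⟩
      rw [hA, hB']
  have h2 : (∀ t < I.n, (I.network p hr m lam).allowed t (extend g t)) ↔
      ∀ v, g (I.ℓ.symm v) ∈ I.lists v := by
    constructor
    · intro h v
      obtain ⟨ht, hc, h3⟩ := h (I.ℓ.symm v) (I.ℓ.symm v).2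
      simpa [hext _ ht] using h3
    · intro h t ht
      refine ⟨ht, by rw [hext t ht]; exact (g _).2, ?_⟩
      simpa [hext _ ht] using h (I.ℓ ⟨t, ht⟩)
  have h3 : (∀ q < I.n * I.n, (I.network p hr m lam).E (q % I.n) (q / I.n) →
      q % I.n < q / I.n → P.Consistent (extend g (q % I.n)) (extend g (q / I.n))) ↔
      ∀ u v, I.G.Adj u v → P.M (g (I.ℓ.symm u)) (g (I.ℓ.symm v)) = 1 := by
    constructor
    · intro h
      -- Each edge is listed once, with its left position first.
      have key : ∀ a b : Fin I.n, a < b → I.G.Adj (I.ℓ a) (I.ℓ b) → P.M (g a) (g b) = 1 := by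
        intro a b hab hadj
        have ha : (b * I.n + a : ℕ) % I.n = a := Nat.mul_add_mod_of_lt a.2
        have hb : (b * I.n + a : ℕ) / I.n = b := mul_add_div_of_lt a.2
        have hlt : (b * I.n + a : ℕ) < I.n * I.n := by
          calc _ < ((b : ℕ) + 1) * I.n := by rw [add_mul]; omega
            _ ≤ _ := Nat.mul_le_mul_right _ b.2
        obtain ⟨hc, hc', h4⟩ := h (b * I.n + a) hlt (by rw [ha, hb]; exact ⟨a.2, b.2, hadj⟩)
          (by rw [ha, hb]; exact hab)
        simpa [ha, hb, hext _ a.2, hext _ b.2] using h4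
      intro u v huv
      rcases lt_trichotomy (I.ℓ.symm u) (I.ℓ.symm v) with h4 | h4 | h4
      · exact key _ _ h4 (by simpa using huv)
      · exact absurd (I.ℓ.symm.injective h4) huv.ne
      · rw [P.M_symm.apply]
        exact key _ _ h4 (by simpa using huv.symm)
    · rintro h q hq ⟨hu, hw, hadj⟩ -
      have h4 := h _ _ hadj
      simp only [Equiv.symm_apply_apply] at h4
      refine ⟨by rw [hext _ hu]; exact (g _).2, by rw [hext _ hw]; exact (g _).2, ?_⟩
      simpa [hext _ hu, hext _ hw] using h4
  rw [h1, h2, h3]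
  tauto

theorem Instance.table_last (hM : ∀ c c' : Fin P.numColors,
      ((lam * ∑ d ∈ Finset.range p.r, p.L c d * p.R d c' : ℤ) : ZMod m) = (P.M c c' : ZMod m))
    (hw : I.weight < I.n * I.N + 1) :
    (I.network p hr m lam).table I.n (I.order * (I.n * I.N + 1) + I.weight) = I.count := by
  classical
  rw [I.count_eq_card p hr m lam hw]
  refine (I.network p hr m lam).table_last P.Consistent ?_ _
  intro c hc c' hc'
  have h1 : (I.network p hr m lam).M c c' = (P.M ⟨c, hc⟩ ⟨c', hc'⟩ : ZMod m) := by
    rw [← hM]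
    simp only [Instance.network, Finset.mul_sum]
    push_cast
    exact Finset.sum_congr rfl fun d _ => mul_assoc _ _ _
  rw [h1]
  split_ifs with h2
  · obtain ⟨_, _, h3⟩ := h2
    rw [h3, Nat.cast_one]
  · rcases P.M_zero_one ⟨c, hc⟩ ⟨c', hc'⟩ with h3 | h3
    · rw [h3, Nat.cast_zero]
    · exact absurd ⟨hc, hc', h3⟩ h2

/-- Requirements beyond the range of the table cannot be met. -/
theorem Instance.count_eq_zero (h : ¬ (I.order ≤ I.n ∧ I.weight < I.n * I.N + 1)) :
    I.count = 0 := by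
  rw [Instance.count, Nat.card_eq_zero]
  refine Or.inl ⟨fun ⟨c, h1, h2, _⟩ => h ⟨?_, ?_⟩⟩
  · rw [← h1]
    simpa using Finset.card_le_univ (Finset.univ.filter fun v => c v ∈ P.special)
  · rw [← h2]
    exact Nat.lt_succ_of_le (I.sum_le _)

theorem Instance.count_le : I.count ≤ P.numColors ^ I.n := by
  have h := Nat.card_le_card_of_injective
    (Subtype.val : {c : Fin I.n → Fin P.numColors // I.IsSolution c} → _) Subtype.val_injective
  simpa [Instance.count] using h

theorem Instance.crossBelow_le_ctw {i : ℕ} (hi : i ≤ I.n) :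
    (I.network p hr m lam).crossBelow i (I.n * I.n) ≤ I.ctw := by
  classical
  rcases i with _ | i
  · rw [Network.crossBelow_none]
    exact Nat.zero_le _
  have hn : 0 < I.n := by omega
  refine le_trans ?_ (Finset.le_sup (f := fun i => (arrangementCut I.G I.ℓ i).card)
    (Finset.mem_univ (⟨i, hi⟩ : Fin I.n)))
  have e : (I.network p hr m lam).crossBelow (i + 1) (I.n * I.n) =
      ((Finset.range (I.n * I.n)).filter
        fun q => (I.network p hr m lam).Cross (i + 1) q).card := by
    rw [Network.crossBelow, List.countP_eq_length_filter]
    rfl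
  rw [e]
  have hlt : ∀ q ∈ (Finset.range (I.n * I.n)).filter
      fun q => (I.network p hr m lam).Cross (i + 1) q,
      q % I.n < I.n ∧ q / I.n < I.n ∧ (I.network p hr m lam).E (q % I.n) (q / I.n) ∧
        q % I.n < i + 1 ∧ i + 1 ≤ q / I.n := by
    intro q hq
    rw [Finset.mem_filter, Finset.mem_range] at hq
    exact ⟨Nat.mod_lt _ hn, Nat.div_lt_of_lt_mul hq.1, hq.2⟩
  refine Finset.card_le_card_of_injOn (fun q => if h : q % I.n < I.n ∧ q / I.n < I.n then
    s(I.ℓ ⟨q % I.n, h.1⟩, I.ℓ ⟨q / I.n, h.2⟩) else s(I.ℓ ⟨0, hn⟩, I.ℓ ⟨0, hn⟩)) ?_ ?_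
  · intro q hq
    obtain ⟨h1, h2, ⟨_, _, h3⟩, h4, h5⟩ := hlt q hq
    simp only [h1, h2, and_self, dif_pos]
    rw [arrangementCut, Finset.mem_coe, Finset.mem_filter, SimpleGraph.mem_edgeFinset,
      SimpleGraph.mem_edgeSet]
    exact ⟨h3, _, _, Fin.mk_le_mk.2 (Nat.le_of_lt_succ h4), Fin.mk_lt_mk.2 h5, rfl⟩
  · intro q hq q' hq' heq
    obtain ⟨h1, h2, _, h4, h5⟩ := hlt q hq
    obtain ⟨h1', h2', _, h4', h5'⟩ := hlt q' hq'
    simp only [h1, h2, h1', h2', and_self, dif_pos, Sym2.eq_iff, I.ℓ.injective.eq_iff,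
      Fin.mk.injEq] at heq
    rw [← Nat.div_add_mod q I.n, ← Nat.div_add_mod q' I.n]
    rcases heq with ⟨h6, h7⟩ | ⟨h6, h7⟩
    · rw [h6, h7]
    · omega

theorem Instance.ctw_le : I.ctw ≤ I.n * I.n := by
  classical
  rw [Instance.ctw, arrangementCutwidth]
  refine Finset.sup_le fun i _ => ?_
  rw [arrangementCut]
  refine (Finset.card_filter_le _ _).trans ?_
  refine (SimpleGraph.card_edgeFinset_le_card_choose_two).trans ?_
  rw [Fintype.card_fin, ← sq]
  exact Nat.choose_le_pow _ _

end Count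

end ColoringLikeProblem

/-! ### The input -/

theorem RAM.natAbs_initialMemory_lt (input : List (List ℤ)) (k : ℕ) (i : ℤ) :
    (initialMemory input k i).natAbs < 2 ^ inputSize input := by
  unfold initialMemory
  have h0 : (0 : ℤ).natAbs < 2 ^ inputSize input := by simp
  split_ifs
  · by_cases hk : k < input.length
    · rw [List.getD_eq_getElem _ _ hk]
      by_cases hi : i.toNat < input[k].length
      · rw [List.getD_eq_getElem _ _ hi]
        have hmem : input[k][i.toNat] ∈ input.flatten :=
          List.mem_flatten.2 ⟨_, List.getElem_mem hk, List.getElem_mem hi⟩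
        have h1 : bitLen input[k][i.toNat] ≤ inputSize input :=
          List.single_le_sum (fun _ _ => Nat.zero_le _) _ (List.mem_map_of_mem hmem)
        exact Nat.size_le.1 ((Nat.le_add_right _ 1).trans h1)
      · rwa [List.getD_eq_default _ _ (not_lt.1 hi)]
    · rw [List.getD_eq_default _ _ (not_lt.1 hk)]
      simp
  · exact h0

theorem RAM.length_flatten_le_inputSize (input : List (List ℤ)) :
    input.flatten.length ≤ inputSize input := by
  rw [inputSize, ← List.length_map (f := bitLen)]
  refine List.length_le_sum_of_one_le _ fun x hx => ?_
  obtain ⟨z, -, rfl⟩ := List.mem_map.1 hx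
  exact one_le_bitLen z

theorem RAM.initialMemory_natCast {input : List (List ℤ)} {k n j : ℕ} {f : Fin n → ℤ}
    (h : input.getD k [] = List.ofFn f) (hj : j < n) :
    initialMemory input k j = f ⟨j, hj⟩ := by
  rw [initialMemory, if_pos (Int.natCast_nonneg j), h, Int.toNat_natCast,
    List.getD_eq_getElem _ _ (by simpa using hj), List.getElem_ofFn]

namespace ColoringLikeProblem

variable {P : ColoringLikeProblem} (I : P.Instance)

theorem Instance.sq_le_size : I.n * I.n + 1 ≤ I.size := by
  refine le_trans ?_ (RAM.length_flatten_le_inputSize _)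
  simp [Instance.encode]
  omega

theorem Instance.initialMemory_numbers : initialMemory I.encode 0 0 = I.n ∧
    initialMemory I.encode 0 1 = I.N ∧ initialMemory I.encode 0 2 = I.order ∧
    initialMemory I.encode 0 3 = I.weight := by
  simp [initialMemory, Instance.encode]

theorem Instance.initialMemory_arrangement (t : Fin I.n) :
    initialMemory I.encode 1 (t : ℕ) = (I.ℓ t : ℕ) :=
  RAM.initialMemory_natCast (f := fun i : Fin I.n => ((I.ℓ i : ℕ) : ℤ)) rfl t.2

theorem Instance.initialMemory_weight (v : Fin I.n) :
    initialMemory I.encode 2 (v : ℕ) = I.ω v :=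
  RAM.initialMemory_natCast (f := fun v : Fin I.n => (I.ω v : ℤ)) rfl v.2

theorem mul_add_lt {a b c d : ℕ} (ha : a < c) (hb : b < d) : a * d + b < c * d :=
  calc a * d + b < (a + 1) * d := by rw [add_mul]; omega
    _ ≤ c * d := Nat.mul_le_mul_right _ ha

open Classical in
theorem Instance.initialMemory_adj (u w : Fin I.n) :
    initialMemory I.encode 3 ((u : ℕ) * (I.n : ℕ) + (w : ℕ)) = if I.G.Adj u w then 1 else 0 := by
  have h := RAM.initialMemory_natCast (input := I.encode) (k := 3) (j := u * I.n + w)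
    (f := fun e : Fin (I.n * I.n) => if I.G.Adj e.divNat e.modNat then 1 else 0) rfl
    (mul_add_lt u.2 w.2)
  push_cast at h
  rw [h]
  have h1 : (⟨u * I.n + w, mul_add_lt u.2 w.2⟩ : Fin (I.n * I.n)).divNat = u :=
    Fin.ext (mul_add_div_of_lt w.2)
  have h2 : (⟨u * I.n + w, mul_add_lt u.2 w.2⟩ : Fin (I.n * I.n)).modNat = w :=
    Fin.ext (Nat.mul_add_mod_of_lt w.2)
  rw [h1, h2]

open Classical in
theorem Instance.initialMemory_list (v : Fin I.n) (c : Fin P.numColors) :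
    initialMemory I.encode 4 ((v : ℕ) * (P.numColors : ℕ) + (c : ℕ)) =
      if c ∈ I.lists v then 1 else 0 := by
  have h := RAM.initialMemory_natCast (input := I.encode) (k := 4) (j := v * P.numColors + c)
    (f := fun e : Fin (I.n * P.numColors) => if e.modNat ∈ I.lists e.divNat then 1 else 0) rfl
    (mul_add_lt v.2 c.2)
  push_cast at h
  rw [h]
  have h1 : (⟨v * P.numColors + c, mul_add_lt v.2 c.2⟩ : Fin (I.n * P.numColors)).divNat = v :=
    Fin.ext (mul_add_div_of_lt c.2)
  have h2 : (⟨v * P.numColors + c, mul_add_lt v.2 c.2⟩ : Fin (I.n * P.numColors)).modNat = c :=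
    Fin.ext (Nat.mul_add_mod_of_lt c.2)
  rw [h1, h2]

theorem Instance.initialMemory_zero {k : ℕ} (hk : 5 ≤ k) (z : ℤ) :
    initialMemory I.encode k z = 0 := by
  have h : I.encode.getD k [] = [] :=
    List.getD_eq_default _ _ (by simpa [Instance.encode] using hk)
  rw [initialMemory, h]
  simp

end ColoringLikeProblem

/-- Processing the vertices does not overwrite the input and the multiplier. -/
theorem Params.not_writes_vertexLoop (p : Params) {k : ℕ} (hk : k < 10) :
    ¬ p.vertexLoop.Writes k := by
  simp only [Params.vertexLoop, Params.vertexStep, Params.introduce, Params.pairLoop,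
    Params.pairStep, Params.contract, Params.expand, Params.collect, sweepUp, sweepDown,
    Prog.Writes, or_false]
  omega

/-! ### Running time and conclusion -/

namespace ColoringLikeProblem

variable {P : ColoringLikeProblem}

theorem Instance.network_digits_le (I : P.Instance) (p : Params) (hr : 0 < p.r) (m : ℕ) (lam : ℤ)
    {i q : ℕ} (hi : i < I.n) (hq : q ≤ I.n * I.n) :
    (I.network p hr m lam).digits i q ≤ I.ctw :=
  ((I.network p hr m lam).digits_le hq).trans
    (max_le (I.crossBelow_le_ctw p hr m lam hi.le) (I.crossBelow_le_ctw p hr m lam hi))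

/-- The number of weight codes. -/
def Instance.codes (I : P.Instance) : ℕ := (I.n + 1) * (I.n * I.N + 1)

/-- The largest number of cells of a table. -/
noncomputable def Instance.maxCells (I : P.Instance) (r : ℕ) : ℕ :=
  r ^ I.ctw * I.codes * P.numColors

/-- After the initialization, the memory describes the network of the instance. -/
theorem Instance.initial_env (I : P.Instance) (p : Params)
    (hspec : ∀ c : Fin P.numColors, p.special c = if c ∈ P.special then 1 else 0)
    (hr : 0 < p.r) {m : ℕ}
    (hm : (m : ℤ) = p.modCoeff.1 * p.C ^ I.n + p.modCoeff.2) {V : ℕ} {τ : Memory}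
    (h : p.Ready I.n I.N V (initialMemory I.encode) τ) :
    Env p (I.network p hr m (p.scaleCoeff.1 * p.C ^ I.n + p.scaleCoeff.2))
      (p.scaleCoeff.1 * p.C ^ I.n + p.scaleCoeff.2) I.codes τ := by
  obtain ⟨hn, -⟩ := I.initialMemory_numbers
  have h0 : τ 0 0 = I.n := by rw [h.input 0 (by decide), hn]
  refine ⟨h0, h.mod.trans hm.symm, h.scale, h.codes, ?_, ?_, ?_, ?_, ?_⟩
  · rintro u hu w hw ⟨_, _, hE⟩
    have h1 := I.initialMemory_arrangement ⟨u, hu⟩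
    have h2 := I.initialMemory_arrangement ⟨w, hw⟩
    simp only at h1 h2
    rw [h0, h.input 1 (by decide), h.input 3 (by decide), h1, h2, I.initialMemory_adj, if_pos hE]
  · rintro u hu w hw hE
    have h1 := I.initialMemory_arrangement ⟨u, hu⟩
    have h2 := I.initialMemory_arrangement ⟨w, hw⟩
    simp only at h1 h2
    rw [h0, h.input 1 (by decide), h.input 3 (by decide), h1, h2, I.initialMemory_adj,
      if_neg fun hE' => hE ⟨hu, hw, hE'⟩]
  · rintro t ht c hc ⟨_, _, hl⟩
    have h1 := I.initialMemory_arrangement ⟨t, ht⟩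
    have h2 := I.initialMemory_list (I.ℓ ⟨t, ht⟩) ⟨c, hc⟩
    rw [if_pos hl] at h2
    simp only at h1
    rw [h.input 1 (by decide), h.input 4 (by decide), h1]
    exact h2
  · rintro t ht c hc hl
    have h1 := I.initialMemory_arrangement ⟨t, ht⟩
    have h2 := I.initialMemory_list (I.ℓ ⟨t, ht⟩) ⟨c, hc⟩
    rw [if_neg fun hl' => hl ⟨ht, hc, hl'⟩] at h2
    simp only at h1
    rw [h.input 1 (by decide), h.input 4 (by decide), h1]
    exact h2
  · rintro t ht c hc
    have h1 := I.initialMemory_arrangement ⟨t, ht⟩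
    simp only at h1
    have h3 := hspec ⟨c, hc⟩
    simp only at h3
    rw [h.input 1 (by decide), h.input 2 (by decide), h1, I.initialMemory_weight, h.mult, h3]
    have h4 : t < I.n ∧ c < P.numColors := ⟨ht, hc⟩
    simp only [Instance.network, dif_pos h4]
    split_ifs <;> simp

/-- The program outputs the number of colorings modulo `m` in time proportional to the size of the
tables, the number of pairs, the number of vertices, and the squared width. -/
theorem Instance.does_program (I : P.Instance) (p : Params) (hC : p.C = P.numColors)
    (hspec : ∀ c : Fin P.numColors, p.special c = if c ∈ P.special then 1 else 0)
    (hr : 0 < p.r) {m V : ℕ} (hm0 : 0 < m)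
    (hm : (m : ℤ) = p.modCoeff.1 * p.C ^ I.n + p.modCoeff.2)
    (hM : ∀ c c' : Fin P.numColors,
        (((p.scaleCoeff.1 * p.C ^ I.n + p.scaleCoeff.2) *
          ∑ d ∈ Finset.range p.r, p.L c d * p.R d c' : ℤ) : ZMod m) = (P.M c c' : ZMod m))
    (hmV : m ≤ V) (hscale : (p.scaleCoeff.1 * p.C ^ I.n + p.scaleCoeff.2).natAbs ≤ V)
    (hpow : p.C ^ I.n ≤ V) (hnV : I.n * I.n ≤ V) (hWV : I.maxCells p.r ≤ V)
    (hinput : Bounded V (initialMemory I.encode)) :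
    Does (width V ^ 2 * (I.maxCells p.r + 1) * (I.n * I.n + 1) * (I.n + 1))
      (initialMemory I.encode) p.program fun τ => τ 0 0 = ((I.count % m : ℕ) : ℤ) := by
  set lam := p.scaleCoeff.1 * (p.C : ℤ) ^ I.n + p.scaleCoeff.2
  have hCpos : 0 < p.C := hC ▸ P.numColors_pos
  have hX : width V ^ 2 ≤ width V ^ 2 * (I.maxCells p.r + 1) * (I.n * I.n + 1) :=
    (Nat.le_mul_of_pos_right _ (Nat.succ_pos _)).trans (Nat.le_mul_of_pos_right _ (Nat.succ_pos _))
  have hX2 := hX.trans (Nat.le_mul_of_pos_right _ (Nat.succ_pos I.n))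
  have hcodesW : I.codes ≤ I.maxCells p.r := by
    rw [Instance.maxCells, mul_comm (p.r ^ I.ctw), mul_assoc]
    exact Nat.le_mul_of_pos_right _ (Nat.mul_pos (pow_pos hr _) P.numColors_pos)
  have hmult : I.n * I.N + 1 ≤ I.codes := Nat.le_mul_of_pos_left _ (Nat.succ_pos _)
  obtain ⟨hn, hN, horder, hweight⟩ := I.initialMemory_numbers
  have hF : Fits p (I.network p hr m lam) lam I.codes V (I.maxCells p.r) :=
    { C_eq := hC
      r_eq := rfl
      L_eq := fun _ _ _ _ => rfl
      R_eq := fun _ _ _ _ => rfl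
      C_pos := P.numColors_pos
      m_pos := hm0
      S_pos := Nat.mul_pos (Nat.succ_pos _) (Nat.succ_pos _)
      m_le := hmV
      W_le := hWV
      n_le := hnV
      cells_le := fun i hi q hq => Nat.mul_le_mul_right _ (Nat.mul_le_mul_right _
        (Nat.pow_le_pow_right hr (I.network_digits_le p hr m lam hi hq))) }
  refine Does.seq ((Params.does_setup hX hinput hn hN (fun k hk z => I.initialMemory_zero hk z)
    hCpos hpow ((Nat.le_mul_self _).trans hnV) ((hmult.trans hcodesW).trans hWV)
    (hcodesW.trans hWV) (by rw [← hm]; exact hmV) hscale).mono le_rfl ?_)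
  intro τ hτ
  have hstart : VertexInv p (I.network p hr m lam) lam I.codes V 0 τ := by
    refine ⟨hτ.bounded, I.initial_env p hspec hr hm hτ, hτ.pos, ?_, ?_, ?_⟩
    · rw [hτ.count, Network.digits_zero, Network.crossBelow_none, pow_zero, Nat.cast_one]
    · intro z hz
      rw [hτ.table, if_neg hz.ne]
    · intro z _
      rw [hτ.table, Network.table_zero]
      split_ifs <;> simp_all
  have hloop := ((hstart.vertexLoop hF le_rfl).and_apply_eq (k := 0)
    (p.not_writes_vertexLoop (by decide))).and_apply_eq (k := 8)
    (p.not_writes_vertexLoop (by decide))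
  refine Does.seq (hloop.mono le_rfl ?_)
  rintro υ ⟨⟨hυ, hυ0⟩, hυ8⟩
  refine Does.store hυ.bounded hX2 ?_
  rw [hτ.input 0 (by decide)] at hυ0
  have hlast : (I.network p hr m lam).digits I.n 0 = 0 :=
    ((I.network p hr m lam).digits_zero _).trans (I.network p hr m lam).crossBelow_last
  rw [write_apply, if_pos ⟨rfl, rfl⟩]
  simp only [Term.eval_mul, Term.eval_mod, Term.eval_load, Term.eval_add, Term.eval_lt, eval_var,
    Term.eval_const, hυ.env.mod, hυ8, hτ.mult, hυ0, hn, horder, hweight]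
  norm_cast
  by_cases h1 : I.order ≤ I.n ∧ I.weight < I.n * I.N + 1
  · rw [if_pos (Nat.lt_succ_of_le h1.1), if_pos h1.2, Nat.cast_one, mul_one, mul_one]
    have h2 : I.order * (I.n * I.N + 1) + I.weight < I.codes :=
      mul_add_lt (Nat.lt_succ_of_le h1.1) h1.2
    have h3 := hυ.table (I.order * (I.n * I.N + 1) + I.weight) (by
      change _ < p.r ^ (I.network p hr m lam).digits I.n 0 * _
      rwa [hlast, pow_zero, one_mul])
    have h4 := h3.trans (I.table_last p hr m lam hM h1.2)
    rw [← Int.cast_natCast I.count, ZMod.intCast_eq_intCast_iff'] at h4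
    rw [h4, Int.natCast_mod]
  · rw [I.count_eq_zero h1]
    by_cases h2 : I.order < I.n + 1
    · rw [if_neg (fun h3 => h1 ⟨Nat.le_of_lt_succ h2, h3⟩)]
      simp
    · rw [if_neg h2]
      simp

/-- The width is linear in the size of the instance. -/
theorem Instance.width_le (I : P.Instance) (r a b : ℕ) :
    width (2 ^ I.size + I.maxCells r + I.n * I.n + a * P.numColors ^ I.n + b) ≤
      (r + P.numColors + a + b + 9) * (I.size + 1) := by
  have hs := I.sq_le_size
  have hnn := Nat.le_mul_self I.n
  have hN : I.N < 2 ^ I.size := by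
    have h : _ < 2 ^ I.size := RAM.natAbs_initialMemory_lt I.encode 0 1
    rw [I.initialMemory_numbers.2.1] at h
    simpa using h
  have hctw := I.ctw_le
  set s := I.size with hs_def
  set e := (r + P.numColors + a + b + 5) * (s + 1) with he
  have two_pow {x y : ℕ} (h : x ≤ y) : 2 ^ x ≤ 2 ^ y := Nat.pow_le_pow_right (by norm_num) h
  have hse : s ≤ e := by rw [he]; nlinarith
  have h1 : 2 ^ s ≤ 2 ^ e := two_pow hse
  have h2 : I.maxCells r ≤ 2 ^ e := by
    have h3 : r ^ I.ctw ≤ 2 ^ (r * s) := by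
      calc r ^ I.ctw ≤ (2 ^ r) ^ I.ctw := Nat.pow_le_pow_left Nat.lt_two_pow_self.le _
        _ = 2 ^ (r * I.ctw) := (pow_mul ..).symm
        _ ≤ 2 ^ (r * s) := two_pow (Nat.mul_le_mul_left _ (by omega))
    have h4 : I.n + 1 ≤ 2 ^ s := by
      have := Nat.lt_two_pow_self (n := s)
      rcases Nat.eq_zero_or_pos I.n with h0 | h0
      · rw [h0]
        exact Nat.one_le_two_pow
      · nlinarith
    have h5 : I.n * I.N + 1 ≤ 2 ^ s * 2 ^ s := by nlinarith
    have h6 : P.numColors ≤ 2 ^ P.numColors := Nat.lt_two_pow_self.le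
    calc r ^ I.ctw * ((I.n + 1) * (I.n * I.N + 1)) * P.numColors
        ≤ 2 ^ (r * s) * (2 ^ s * (2 ^ s * 2 ^ s)) * 2 ^ P.numColors := by gcongr
      _ = 2 ^ (r * s + (s + (s + s)) + P.numColors) := by simp only [pow_add]
      _ ≤ 2 ^ e := two_pow (by rw [he]; nlinarith)
  have h3 : I.n * I.n ≤ 2 ^ e := by
    have := Nat.lt_two_pow_self (n := s)
    omega
  have h4 : a * P.numColors ^ I.n ≤ 2 ^ e := by
    calc a * P.numColors ^ I.n ≤ 2 ^ a * (2 ^ P.numColors) ^ I.n := by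
          gcongr <;> exact Nat.lt_two_pow_self.le
      _ = 2 ^ (a + P.numColors * I.n) := by rw [pow_add, pow_mul]
      _ ≤ 2 ^ e := two_pow (by rw [he]; nlinarith)
  have h5 : b ≤ 2 ^ e := Nat.lt_two_pow_self.le.trans (two_pow (by rw [he]; nlinarith))
  have h6 : (2 ^ s + I.maxCells r + I.n * I.n + a * P.numColors ^ I.n + b).size ≤ e + 3 := by
    rw [Nat.size_le, pow_add]
    have := Nat.two_pow_pos e
    omega
  calc width _ ≤ e + 4 := Nat.add_le_add_right h6 1
    _ ≤ _ := by rw [he]; nlinarith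

/-- The factor `N` of the time bound stems from the weight codes. -/
theorem Instance.maxCells_le (I : P.Instance) {r : ℕ} (hr : 0 < r) :
    I.maxCells r + 1 ≤ r ^ I.ctw * I.N * (P.numColors * (I.size + 1) ^ 2 + 1) := by
  have hs := I.sq_le_size
  have hnn := Nat.le_mul_self I.n
  have hN := I.N_pos
  have h1 : 1 ≤ r ^ I.ctw * I.N := Nat.mul_pos (pow_pos hr _) hN
  have h2 : I.codes ≤ I.N * (I.size + 1) ^ 2 := by
    calc (I.n + 1) * (I.n * I.N + 1) ≤ (I.size + 1) * ((I.size + 1) * I.N) := by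
          refine Nat.mul_le_mul (by omega) ?_
          nlinarith
      _ = _ := by ring
  calc I.maxCells r + 1 ≤ r ^ I.ctw * (I.N * (I.size + 1) ^ 2) * P.numColors + r ^ I.ctw * I.N :=
        Nat.add_le_add (Nat.mul_le_mul_right _ (Nat.mul_le_mul_left _ h2)) h1
    _ = _ := by ring

end ColoringLikeProblem

theorem mainTheorem1 (P : ColoringLikeProblem)
    (hrank : Real.sqrt (P.numColors : ℝ) ≤ (P.rank : ℝ)) :
    P.SolvableInTimeOStar (fun I => P.rank ^ I.ctw * I.N) := by
  have hr : 0 < P.rank := by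
    have h : 0 < Real.sqrt (P.numColors : ℝ) := Real.sqrt_pos.2 (by exact_mod_cast P.numColors_pos)
    exact_mod_cast h.trans_le hrank
  obtain ⟨p, hC, hpr, hspec, hp⟩ := P.exists_params
  set a := p.modCoeff.1.natAbs + p.scaleCoeff.1.natAbs + 1 with ha
  set b := p.modCoeff.2.natAbs + p.scaleCoeff.2.natAbs with hb
  set k := p.r + P.numColors + a + b + 9 with hk
  refine ⟨p.program, Polynomial.C (p.program.factor * k ^ 2) * (Polynomial.X + 1) ^ 4 *
    (Polynomial.C P.numColors * (Polynomial.X + 1) ^ 2 + 1), fun I => ?_⟩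
  obtain ⟨m, hm0, hm, hM, hans⟩ := hp I.n
  -- A bound for all numbers that occur: input, addresses, counters, and modulus and scaling factor.
  set V := 2 ^ I.size + I.maxCells p.r + I.n * I.n + a * P.numColors ^ I.n + b with hV
  have hpow := Nat.two_pow_pos I.size
  have haC : a * P.numColors ^ I.n = p.modCoeff.1.natAbs * P.numColors ^ I.n +
      p.scaleCoeff.1.natAbs * P.numColors ^ I.n + P.numColors ^ I.n := by
    rw [ha]
    ring
  have hlin : ∀ x y : ℤ, (x * (p.C : ℤ) ^ I.n + y).natAbs ≤
      x.natAbs * P.numColors ^ I.n + y.natAbs := by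
    intro x y
    refine (Int.natAbs_add_le _ _).trans_eq ?_
    rw [Int.natAbs_mul, Int.natAbs_pow, Int.natAbs_natCast, hC]
  obtain ⟨τ, t, h1, h2, h3⟩ := I.does_program p hC hspec (hpr ▸ hr) (V := V) hm0 hm hM
    (by have := hlin p.modCoeff.1 p.modCoeff.2; rw [← hm] at this; omega)
    (by have := hlin p.scaleCoeff.1 p.scaleCoeff.2; omega)
    (by rw [hC]; omega) (by omega) (by omega)
    (fun k i => (RAM.natAbs_initialMemory_lt I.encode k i).le.trans (by
      change 2 ^ I.size ≤ _
      omega))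
  refine ⟨τ, t, h1, ?_, h2.trans ?_⟩
  · rw [h3, hans _ I.count_le, ColoringLikeProblem.Instance.answer]
  · have h4 := I.width_le p.r a b
    have h5 := I.maxCells_le (r := p.r) (hpr ▸ hr)
    have h6 := I.sq_le_size
    have h7 : I.n + 1 ≤ I.size + 1 := by
      have := Nat.le_mul_self I.n
      omega
    rw [← hV, ← hk] at h4
    rw [hpr] at h5
    simp only [Polynomial.eval_mul, Polynomial.eval_add, Polynomial.eval_pow, Polynomial.eval_C,
      Polynomial.eval_X, Polynomial.eval_one]
    rw [hpr]
    calc _ ≤ p.program.factor * ((k * (I.size + 1)) ^ 2 *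
          (P.rank ^ I.ctw * I.N * (P.numColors * (I.size + 1) ^ 2 + 1)) * (I.size + 1) *
          (I.size + 1)) := by gcongr; omega
      _ = _ := by ring
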